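/- Let $\mathbb T=\mathbb R/2\pi\mathbb Z$, $\hat f(k)=\int_{\mathbb T}f(x)e^{-ikx}\,dx$, $\|f\|_{H^s(\mathbb T)}^2=\frac1{2\pi}\sum_{k\in\mathbb Z}(1+k^2)^s|\hat f(k)|^2$. For an integer $M\ge1$ let $h=\pi/M$, $\mathbb T_h=\{hj: -M\le j<M\}\cong\mathbb Z/2M\mathbb Z$, and for $g:\mathbb T_h\to\mathbb C$ and $-M\le k<M$ put $\mathcal F_h[g](k)=h\sum_{x\in\mathbb T_h}g(x)e^{-ikx}$. Let $(-\Delta_h)^{\alpha/2}=\mathcal F_h^{-1}\sigma_h\mathcal F_h$ with $\sigma_h(k)=\left|\frac2h\sin\frac{hk}2\right|^\alpha$. Discretization and linear interpolation are $$d_hf(x)=\frac1h\int_x^{x+h}f(x')\,dx'\quad(x\in\mathbb T_h),\qquad p_hg(x)=g(x_0)+\frac{g(x_0+h)-g(x_0)}h(x-x_0)\quad(x_0\in\mathbb T_h,\ x\in[x_0,x_0+h)).$$ Let $\alpha\in(1,2]$, $\mu\in\{1,-1\}$ and $u_0\in H^{\alpha/2}(\mathbb T)$. Let $u(t)=S(t)u_0$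 be the solution in $C([0,T];H^{\alpha/2}(\mathbb T))$ of $i\partial_tu=(-\Delta)^{\alpha/2}u+\mu|u|^2u$, $u(0)=u_0$, in the sense that $$u(t)=U(t)u_0-i\mu\int_0^tU(t-\tau)\left(|u|^2u\right)(\tau)\,d\tau,\qquad \widehat{U(t)f}(k)=e^{-it|k|^\alpha}\hat f(k),$$ and let $u_h(t)=S_h(t)d_hu_0$ be the solution of $i\dot u_h=(-\Delta_h)^{\alpha/2}u_h+\mu|u_h|^2u_h$ on $\mathbb T_h$, $u_h(0)=d_hu_0$. Suppose that $\hat u_0$ has finite support and put $k_m=\max\{|k|:\hat u_0(k)\ne0\}$ (with $k_m=0$ if $u_0=0$). Suppose also that there are $T,k_c,h_0>0$ such that, for all $h=\pi/M<h_0$ and all $|t|\le T$, $\mathcal F_h[u_h(t)](k)=0$ for every $k\in\{-M,\dots,M-1\}$ with $|k|>k_c$. Let $k_{max}=\max(k_m,k_c)$. Then there are constants $C_0,C>0$, depending only on $\alpha$ and on (an upper bound for) $\|u_0\|_{H^{\alpha/2}}$, such that for all $h=\pi/M$ with $$h<C_0\min\left(h_0,\ (3k_{max})^{-1},\ (Tk_{max}^{1+\alpha})^{-1},\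 (T^2k_{max}^{1+\alpha})^{-1}\right)$$ and all $t\in[0,T]$, $$\|p_hS_h(t)d_hu_0-S(t)u_0\|_{L^2(\mathbb T)}\le C\,h\,k_{max}^{1-\frac\alpha2}.$$ -/

import Mathlib

open scoped Topology

noncomputable section

namespace FracDNLS

/-- The circle `ℝ / 2πℤ`; its `volume` is the Lebesgue measure of total mass `2π`. -/
abbrev Torus : Type := AddCircle (2 * Real.pi)

instance two_pi_pos_fact : Fact (0 < 2 * Real.pi) := ⟨Real.two_pi_pos⟩

/-! ### Sobolev spaces on the circle -/

/-- The Fourier transform `f̂(k) = ∫ f(x) e^{-ikx} dx` over the circle.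
(`fourierCoeff` is normalised by the factor `1 / 2π`.) -/
def torusFourier (f : Torus → ℂ) (k : ℤ) : ℂ := (2 * Real.pi : ℂ) * fourierCoeff f k

/-- `f ∈ H^s(𝕋)`, for `s ≥ 0`: `f` is in `L²` and `∑ ⟨k⟩^{2s} |f̂(k)|² < ∞`. -/
def MemHs (s : ℝ) (f : Torus → ℂ) : Prop :=
  MeasureTheory.MemLp f 2 MeasureTheory.volume ∧
    Summable fun k : ℤ => (1 + (k : ℝ) ^ 2) ^ s * ‖torusFourier f k‖ ^ 2

/-- The norm of `H^s(𝕋)`: `‖f‖² = (2π)⁻¹ ∑ ⟨k⟩^{2s} |f̂(k)|²`. -/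
def hsNorm (s : ℝ) (f : Torus → ℂ) : ℝ :=
  Real.sqrt ((2 * Real.pi)⁻¹ * ∑' k : ℤ, (1 + (k : ℝ) ^ 2) ^ s * ‖torusFourier f k‖ ^ 2)

/-- `u ∈ C(I; H^s(𝕋))`. -/
def ContinuousInHs (s : ℝ) (u : ℝ → Torus → ℂ) (I : Set ℝ) : Prop :=
  (∀ t ∈ I, MemHs s (u t)) ∧
    ∀ t₀ ∈ I, Filter.Tendsto (fun t => hsNorm s (u t - u t₀)) (𝓝[I] t₀) (𝓝 0)

/-- `max {|k| : f̂(k) ≠ 0}`, meaningful when `f̂` has finite support; it is `0` for `f = 0`. -/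
def maxFreq (f : Torus → ℂ) : ℝ :=
  sSup ((fun k : ℤ => |(k : ℝ)|) '' Function.support (torusFourier f))

/-! ### The fractional nonlinear Schrödinger equation on the circle -/

/-- The multiplier `e^{-it|k|^α}` of the propagator `U(t) = e^{-it(-Δ)^{α/2}}`. -/
def propagator (α t : ℝ) (k : ℤ) : ℂ :=
  Complex.exp (-(Complex.I * (t : ℂ) * ((|(k : ℝ)| ^ α : ℝ) : ℂ)))

/-- `u ∈ C([0,T]; H^{α/2}(𝕋))` solves `i ∂ₜu = (-Δ)^{α/2} u + μ |u|² u`, `u(0) = u₀`, on `[0,T]`,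
in the Duhamel form `u(t) = U(t) u₀ - iμ ∫₀ᵗ U(t-τ) (|u|² u)(τ) dτ`. The identity is between
elements of `L²(𝕋)`, and is written for each Fourier coefficient. -/
def IsTorusSolution (α μ T : ℝ) (u₀ : Torus → ℂ) (u : ℝ → Torus → ℂ) : Prop :=
  ContinuousInHs (α / 2) u (Set.Icc 0 T) ∧
    ∀ t ∈ Set.Icc 0 T, ∀ k : ℤ,
      torusFourier (u t) k = propagator α t k * torusFourier u₀ k -
        Complex.I * (μ : ℂ) * ∫ τ in (0 : ℝ)..t,
          propagator α (t - τ) k * torusFourier (fun x => ((‖u τ x‖ ^ 2 : ℝ) : ℂ) * u τ x) k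

/-! ### The periodic lattice -/

/-- The mesh `h = π / M`. -/
def mesh (M : ℕ) : ℝ := Real.pi / M

/-- Complex functions on the lattice `𝕋_h = h (ℤ / 2Mℤ)`, `h = π / M`: the value at the
lattice point `x = h j` is the value at `j`. -/
abbrev LatticeFun (M : ℕ) : Type := ZMod (2 * M) → ℂ

/-- `F_h[f](k) = h ∑_{x ∈ 𝕋_h} f(x) e^{-ikx}`, the sum being over `x = h j`, `-M ≤ j < M`. -/
def latticeFourier (M : ℕ) (f : LatticeFun M) (k : ℤ) : ℂ :=
  (mesh M : ℂ) * ∑ j ∈ Finset.Ico (-(M : ℤ)) (M : ℤ),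
    f (j : ZMod (2 * M)) * Complex.exp (-(Complex.I * (k : ℂ) * ((mesh M : ℂ) * (j : ℂ))))

/-- `F_h⁻¹[g](x) = (2π)⁻¹ ∑_{-M ≤ k < M} g(k) e^{ikx}` at the lattice point `x = h j`. -/
def latticeFourierInv (M : ℕ) (g : ℤ → ℂ) : LatticeFun M := fun j =>
  (2 * Real.pi : ℂ)⁻¹ * ∑ k ∈ Finset.Ico (-(M : ℤ)) (M : ℤ),
    g k * Complex.exp (Complex.I * (k : ℂ) * ((mesh M : ℂ) * (j.val : ℂ)))

/-- The symbol `σ_h(k) = |(2/h) sin(hk/2)|^α` of `(-Δ_h)^{α/2}`. -/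
def latticeSymbol (α : ℝ) (M : ℕ) (k : ℤ) : ℝ :=
  |2 / mesh M * Real.sin (mesh M * k / 2)| ^ α

/-- The discrete fractional Laplacian `(-Δ_h)^{α/2} = F_h⁻¹ σ_h F_h`. -/
def latticeFracLaplacian (α : ℝ) (M : ℕ) (f : LatticeFun M) : LatticeFun M :=
  latticeFourierInv M fun k => (latticeSymbol α M k : ℂ) * latticeFourier M f k

/-- `v` solves `i v' = (-Δ_h)^{α/2} v + μ |v|² v`, `v(0) = v₀`, on the time interval `[-T,T]`. -/
def IsLatticeSolution (α μ T : ℝ) (M : ℕ) (v₀ : LatticeFun M) (v : ℝ → LatticeFun M) : Prop :=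
  v 0 = v₀ ∧
    ∀ t ∈ Set.Icc (-T) T, ∀ j : ZMod (2 * M),
      HasDerivWithinAt (fun τ => v τ j)
        (-Complex.I * (latticeFracLaplacian α M (v t) j +
          (μ : ℂ) * (((‖v t j‖ ^ 2 : ℝ) : ℂ) * v t j)))
        (Set.Icc (-T) T) t

/-- The discretization `d_h f(x) = h⁻¹ ∫_x^{x+h} f`, at the lattice point `x = h j`. -/
def discretize (M : ℕ) (f : Torus → ℂ) : LatticeFun M := fun j =>
  (mesh M : ℂ)⁻¹ * ∫ y in (mesh M * j.val)..(mesh M * j.val + mesh M), f ((y : ℝ) : Torus)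

/-- The linear interpolation
`p_h g(x) = g(x₀) + (g(x₀+h) - g(x₀)) / h * (x - x₀)` for `x ∈ [x₀, x₀+h)`, `x₀ ∈ 𝕋_h`, where
`x` runs over the fundamental domain `[-π, π)` and `x₀ = h ⌊x/h⌋`. -/
def interpolate (M : ℕ) (g : LatticeFun M) : Torus → ℂ := fun x =>
  let y : ℝ := (AddCircle.equivIco (2 * Real.pi) (-Real.pi) x : ℝ)
  let j : ℤ := ⌊y / mesh M⌋
  g (j : ZMod (2 * M)) +
    (g ((j + 1 : ℤ) : ZMod (2 * M)) - g (j : ZMod (2 * M))) / (mesh M : ℂ) *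
      ((y - mesh M * j : ℝ) : ℂ)

end FracDNLS

end

open scoped Topology

noncomputable section

namespace FracDNLS

open MeasureTheory

/-! ### Fourier analysis on the lattice -/

/-! The band limit is so rigid that both solutions are single plane waves, and the estimate reduces
to comparing two explicit exponentials.

Let `a` be the largest frequency that the lattice solution shows at any time in `(-T, T)`, say at
`t₀`, and let `b` be the smallest one present at `t₀`. If `b < a`, the cubic term at `t₀` has a
nonzero coefficient at `2a - b > a`: since `3K < M`, no other triple of frequencies reaches `2a - b`
modulo `2M` (`latticeFourier_latticeCubic_top`). But the solution has no coefficient at `2a - b` at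
any time, so the derivative of that coefficient is zero, contradicting the equation. Hence `v t₀` is
one mode, and ODE uniqueness makes `v` a plane wave (`exists_eq_latticePlaneWave`).

At time `0`, averaging multiplies mode `k` by a factor `m(k)`, nonzero when `|k|h < 1`, so `u₀` is
itself one mode `c e^{ikx}`. Uniqueness for the Duhamel equation (`IsDuhamelSolution.unique`, using
`H^{α/2} ⊂ C` for `α > 1`) gives `u = c e^{i(kx - ωt)}` with `ω = |k|^α + μ|c|²`. The lattice wave
has amplitude `c m(k)` and frequency `σ_h(k) + μ|c m(k)|²`. Amplitude and interpolation errors are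
`O(|k|h)`. The frequency error is `O((|k|^α + |c|²)(|k|h)²)`; multiplied by `t ≤ T` it is again
`O(|k|h)`, because `T h K^{1+α} ≤ 1`. Finally `|c| |k| ≤ ‖u₀‖_{H^{α/2}} |k|^{1-α/2}`. -/

theorem mesh_pos (M : ℕ) [NeZero M] : 0 < mesh M :=
  div_pos Real.pi_pos (Nat.cast_pos.2 (NeZero.pos M))

theorem mesh_mul (M : ℕ) [NeZero M] : mesh M * M = Real.pi :=
  div_mul_cancel₀ _ (Nat.cast_ne_zero.2 (NeZero.ne M))

theorem intCast_inj_of_abs_sub_lt {M : ℕ} {k l : ℤ} (h : |k - l| < 2 * (M : ℤ))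
    (hkl : (k : ZMod (2 * M)) = l) : k = l := by
  rw [eq_comm, ZMod.intCast_eq_intCast_iff_dvd_sub] at hkl
  have := Int.eq_zero_of_abs_lt_dvd hkl (by push_cast; exact h)
  omega

theorem intCast_injOn_Ico {M : ℕ} {k l : ℤ} (hk : k ∈ Finset.Ico (-(M : ℤ)) (M : ℤ))
    (hl : l ∈ Finset.Ico (-(M : ℤ)) (M : ℤ)) (hkl : (k : ZMod (2 * M)) = l) : k = l := by
  rw [Finset.mem_Ico] at hk hl
  exact intCast_inj_of_abs_sub_lt (abs_lt.2 ⟨by omega, by omega⟩) hkl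

theorem sum_Ico_intCast (M : ℕ) [NeZero M] (f : ZMod (2 * M) → ℂ) :
    ∑ j ∈ Finset.Ico (-(M : ℤ)) (M : ℤ), f (j : ZMod (2 * M)) = ∑ j, f j := by
  classical
  have hinj : Set.InjOn (fun j : ℤ => (j : ZMod (2 * M))) (Finset.Ico (-(M : ℤ)) (M : ℤ)) :=
    fun a ha b hb hab => intCast_injOn_Ico ha hb hab
  rw [← Finset.sum_image (f := f) hinj]
  congr 1
  apply Finset.eq_univ_of_card
  rw [Finset.card_image_of_injOn hinj, Int.card_Ico, ZMod.card]
  omega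

/-- The lattice function `x ↦ e^{ikx}`. -/
def latticeMode (M : ℕ) (k : ℤ) : LatticeFun M := fun j =>
  Complex.exp (Complex.I * (k : ℂ) * ((mesh M : ℂ) * (j.val : ℂ)))

/-- Turns orthogonality of the modes into the vanishing of sums of a primitive additive character of
`ZMod (2 * M)`. -/
theorem exp_mesh_eq_stdAddChar (M : ℕ) [NeZero M] (k n : ℤ) :
    Complex.exp (Complex.I * (k : ℂ) * ((mesh M : ℂ) * (n : ℂ))) =
      ZMod.stdAddChar (((k * n : ℤ)) : ZMod (2 * M)) := by
  rw [ZMod.stdAddChar_coe]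
  congr 1
  have hM : (M : ℂ) ≠ 0 := Nat.cast_ne_zero.2 (NeZero.ne M)
  simp only [mesh]
  push_cast
  field_simp

theorem latticeMode_eq_stdAddChar (M : ℕ) [NeZero M] (k : ℤ) (j : ZMod (2 * M)) :
    latticeMode M k j = ZMod.stdAddChar ((k : ZMod (2 * M)) * j) := by
  have := exp_mesh_eq_stdAddChar M k j.val
  push_cast [ZMod.natCast_zmod_val] at this
  exact this

theorem latticeMode_intCast (M : ℕ) [NeZero M] (k n : ℤ) :
    latticeMode M k (n : ZMod (2 * M)) =
      Complex.exp (Complex.I * (k : ℂ) * ((mesh M : ℂ) * (n : ℂ))) := by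
  rw [latticeMode_eq_stdAddChar, exp_mesh_eq_stdAddChar]
  push_cast
  rfl

theorem latticeMode_add (M : ℕ) [NeZero M] (k l : ℤ) (j : ZMod (2 * M)) :
    latticeMode M (k + l) j = latticeMode M k j * latticeMode M l j := by
  simp only [latticeMode_eq_stdAddChar, ← AddChar.map_add_eq_mul]
  push_cast
  ring_nf

theorem norm_latticeMode (M : ℕ) (k : ℤ) (j : ZMod (2 * M)) : ‖latticeMode M k j‖ = 1 := by
  have : Complex.I * (k : ℂ) * ((mesh M : ℂ) * (j.val : ℂ)) =
      ((k * (mesh M * j.val) : ℝ) : ℂ) * Complex.I := by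
    push_cast; ring
  rw [latticeMode, this, Complex.norm_exp_ofReal_mul_I]

theorem conj_latticeMode (M : ℕ) (k : ℤ) (j : ZMod (2 * M)) :
    (starRingEnd ℂ) (latticeMode M k j) = latticeMode M (-k) j := by
  rw [latticeMode, latticeMode, ← Complex.exp_conj]
  simp

theorem latticeFourier_eq_sum (M : ℕ) [NeZero M] (f : LatticeFun M) (k : ℤ) :
    latticeFourier M f k = (mesh M : ℂ) * ∑ j, f j * latticeMode M (-k) j := by
  rw [latticeFourier, ← sum_Ico_intCast]
  congr 1
  refine Finset.sum_congr rfl fun j _ => ?_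
  rw [latticeMode_intCast]
  push_cast
  ring_nf

theorem latticeFourier_add (M : ℕ) (f g : LatticeFun M) (k : ℤ) :
    latticeFourier M (f + g) k = latticeFourier M f k + latticeFourier M g k := by
  simp only [latticeFourier, Pi.add_apply, add_mul, Finset.sum_add_distrib, mul_add]

theorem latticeFourier_smul (M : ℕ) (c : ℂ) (f : LatticeFun M) (k : ℤ) :
    latticeFourier M (c • f) k = c * latticeFourier M f k := by
  simp only [latticeFourier, Pi.smul_apply, smul_eq_mul, Finset.mul_sum]
  exact Finset.sum_congr rfl fun j _ => by ring

/-- `F_h` at the frequency `k`, as a linear functional. -/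
def latticeFourierLin (M : ℕ) (k : ℤ) : LatticeFun M →ₗ[ℂ] ℂ where
  toFun f := latticeFourier M f k
  map_add' f g := latticeFourier_add M f g k
  map_smul' c f := latticeFourier_smul M c f k

theorem latticeFourier_sum {ι : Type*} (M : ℕ) (s : Finset ι) (f : ι → LatticeFun M) (k : ℤ) :
    latticeFourier M (∑ i ∈ s, f i) k = ∑ i ∈ s, latticeFourier M (f i) k :=
  map_sum (latticeFourierLin M k) f s

/-- Orthogonality with aliasing. The frequencies are arbitrary integers because the cubic term
produces `k₁ - k₂ + k₃` outside `[-M, M)`. -/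
theorem latticeFourier_latticeMode (M : ℕ) [NeZero M] (k l : ℤ) :
    latticeFourier M (latticeMode M k) l =
      if (k : ZMod (2 * M)) = l then (2 * Real.pi : ℂ) else 0 := by
  rw [latticeFourier_eq_sum]
  have : ∀ j : ZMod (2 * M), latticeMode M k j * latticeMode M (-l) j =
      ZMod.stdAddChar (j * ((k : ZMod (2 * M)) - (l : ZMod (2 * M)))) := fun j => by
    rw [← latticeMode_add, latticeMode_eq_stdAddChar]
    push_cast
    ring_nf
  simp_rw [this]
  rw [AddChar.sum_mulShift _ (ZMod.isPrimitive_stdAddChar _)]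
  have h := congrArg (fun x : ℝ => (x : ℂ)) (mesh_mul M)
  push_cast at h
  by_cases hkl : (k : ZMod (2 * M)) = l
  · simp only [hkl, sub_self, if_true, ZMod.card]
    push_cast
    rw [← h]; ring
  · simp [hkl, sub_eq_zero]

theorem latticeFourierInv_eq_sum (M : ℕ) (g : ℤ → ℂ) :
    latticeFourierInv M g =
      ∑ k ∈ Finset.Ico (-(M : ℤ)) (M : ℤ), ((2 * Real.pi : ℂ)⁻¹ * g k) • latticeMode M k := by
  funext j
  simp only [latticeFourierInv, Finset.sum_apply, Pi.smul_apply, smul_eq_mul, Finset.mul_sum,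
    latticeMode, mul_assoc]

theorem two_pi_ne_zero' : (2 * Real.pi : ℂ) ≠ 0 := by
  simp [Real.pi_ne_zero]

theorem latticeFourier_latticeFourierInv (M : ℕ) [NeZero M] (g : ℤ → ℂ) {l : ℤ}
    (hl : l ∈ Finset.Ico (-(M : ℤ)) (M : ℤ)) :
    latticeFourier M (latticeFourierInv M g) l = g l := by
  rw [latticeFourierInv_eq_sum, latticeFourier_sum, Finset.sum_eq_single_of_mem l hl]
  · rw [latticeFourier_smul, latticeFourier_latticeMode, if_pos rfl]
    field_simp [two_pi_ne_zero']
  · intro k hk hkl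
    rw [latticeFourier_smul, latticeFourier_latticeMode,
      if_neg fun h => hkl (intCast_injOn_Ico hk hl h), mul_zero]

theorem latticeFourierInv_latticeFourier (M : ℕ) [NeZero M] (f : LatticeFun M) :
    latticeFourierInv M (latticeFourier M f) = f := by
  funext j
  have key : ∀ i : ZMod (2 * M), ∑ k ∈ Finset.Ico (-(M : ℤ)) (M : ℤ),
      latticeMode M (-k) i * latticeMode M k j = if i = j then (2 * M : ℂ) else 0 := fun i => by
    have : ∀ k : ℤ, latticeMode M (-k) i * latticeMode M k j =
        ZMod.stdAddChar ((k : ZMod (2 * M)) * (j - i)) := fun k => by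
      rw [latticeMode_eq_stdAddChar, latticeMode_eq_stdAddChar, ← AddChar.map_add_eq_mul]
      push_cast
      ring_nf
    simp_rw [this]
    rw [sum_Ico_intCast M fun k => ZMod.stdAddChar (k * (j - i)),
      AddChar.sum_mulShift _ (ZMod.isPrimitive_stdAddChar _)]
    by_cases hij : i = j
    · simp [hij]
    · simp [hij, sub_eq_zero, Ne.symm hij]
  have h := congrArg (fun x : ℝ => (x : ℂ)) (mesh_mul M)
  push_cast at h
  calc latticeFourierInv M (latticeFourier M f) j
      = (2 * Real.pi : ℂ)⁻¹ * ∑ k ∈ Finset.Ico (-(M : ℤ)) (M : ℤ), ∑ i,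
          (mesh M : ℂ) * (f i * (latticeMode M (-k) i * latticeMode M k j)) := by
        rw [latticeFourierInv]
        congr 1
        refine Finset.sum_congr rfl fun k _ => ?_
        rw [latticeFourier_eq_sum, Finset.mul_sum, Finset.sum_mul]
        exact Finset.sum_congr rfl fun i _ => by rw [latticeMode, latticeMode]; ring
    _ = (2 * Real.pi : ℂ)⁻¹ * ∑ i, (mesh M : ℂ) * (f i * if i = j then (2 * M : ℂ) else 0) := by
        rw [Finset.sum_comm]
        simp_rw [← Finset.mul_sum, key]
    _ = f j := by
        simp only [mul_ite, mul_zero, Finset.sum_ite_eq', Finset.mem_univ, if_true]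
        have h2 := two_pi_ne_zero'
        have : (mesh M : ℂ) * (f j * (2 * M)) = (2 * Real.pi) * f j := by rw [← h]; ring
        rw [this, inv_mul_cancel_left₀ h2]

theorem eq_sum_latticeMode (M : ℕ) [NeZero M] (f : LatticeFun M) :
    f = ∑ k ∈ Finset.Ico (-(M : ℤ)) (M : ℤ),
      ((2 * Real.pi : ℂ)⁻¹ * latticeFourier M f k) • latticeMode M k := by
  rw [← latticeFourierInv_eq_sum, latticeFourierInv_latticeFourier]

theorem latticeFourier_latticeFracLaplacian (α : ℝ) (M : ℕ) [NeZero M] (f : LatticeFun M) {k : ℤ}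
    (hk : k ∈ Finset.Ico (-(M : ℤ)) (M : ℤ)) :
    latticeFourier M (latticeFracLaplacian α M f) k =
      latticeSymbol α M k * latticeFourier M f k :=
  latticeFourier_latticeFourierInv M _ hk

theorem latticeFracLaplacian_smul_latticeMode (α : ℝ) (M : ℕ) [NeZero M] (c : ℂ) {k : ℤ}
    (hk : k ∈ Finset.Ico (-(M : ℤ)) (M : ℤ)) :
    latticeFracLaplacian α M (c • latticeMode M k) =
      (latticeSymbol α M k * c) • latticeMode M k := by
  rw [latticeFracLaplacian, latticeFourierInv_eq_sum, Finset.sum_eq_single_of_mem k hk]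
  · rw [latticeFourier_smul, latticeFourier_latticeMode, if_pos rfl]
    congr 1
    field_simp [two_pi_ne_zero']
  · intro l hl hkl
    rw [latticeFourier_smul, latticeFourier_latticeMode,
      if_neg fun h => hkl (intCast_injOn_Ico hk hl h).symm]
    simp

/-! ### Band-limited lattice solutions are plane waves -/

/-- The nonlinearity `|v|² v` on the lattice. -/
def latticeCubic {M : ℕ} (v : LatticeFun M) : LatticeFun M := fun j => ((‖v j‖ ^ 2 : ℝ) : ℂ) * v j

/-- The vector field of the lattice equation. -/
def latticeField (α μ : ℝ) (M : ℕ) (v : LatticeFun M) : LatticeFun M := fun j =>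
  -Complex.I * (latticeFracLaplacian α M v j + (μ : ℂ) * latticeCubic v j)

theorem ofReal_norm_sq_mul (z : ℂ) : ((‖z‖ ^ 2 : ℝ) : ℂ) * z = z * (starRingEnd ℂ) z * z := by
  rw [Complex.mul_conj, Complex.normSq_eq_norm_sq]

theorem latticeCubic_smul_latticeMode (M : ℕ) (c : ℂ) (k : ℤ) :
    latticeCubic (c • latticeMode M k) = (((‖c‖ ^ 2 : ℝ) : ℂ) * c) • latticeMode M k := by
  funext j
  simp [latticeCubic, norm_latticeMode, mul_assoc]

theorem latticeFourier_latticeCubic (M : ℕ) [NeZero M] (v : LatticeFun M) (c : ℤ → ℂ)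
    (hv : v = ∑ k ∈ Finset.Ico (-(M : ℤ)) (M : ℤ), c k • latticeMode M k) (l : ℤ) :
    latticeFourier M (latticeCubic v) l =
      ∑ k₁ ∈ Finset.Ico (-(M : ℤ)) (M : ℤ), ∑ k₂ ∈ Finset.Ico (-(M : ℤ)) (M : ℤ),
        ∑ k₃ ∈ Finset.Ico (-(M : ℤ)) (M : ℤ), c k₁ * (starRingEnd ℂ) (c k₂) * c k₃ *
          latticeFourier M (latticeMode M (k₁ - k₂ + k₃)) l := by
  have : latticeCubic v =
      ∑ k₁ ∈ Finset.Ico (-(M : ℤ)) (M : ℤ), ∑ k₂ ∈ Finset.Ico (-(M : ℤ)) (M : ℤ),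
        ∑ k₃ ∈ Finset.Ico (-(M : ℤ)) (M : ℤ), (c k₁ * (starRingEnd ℂ) (c k₂) * c k₃) •
          latticeMode M (k₁ - k₂ + k₃) := by
    funext j
    have hj : v j = ∑ k ∈ Finset.Ico (-(M : ℤ)) (M : ℤ), c k * latticeMode M k j := by
      rw [hv]; simp
    rw [latticeCubic, ofReal_norm_sq_mul, hj, map_sum, Finset.sum_mul_sum, Finset.sum_mul]
    simp only [Finset.sum_apply, Pi.smul_apply, smul_eq_mul]
    refine Finset.sum_congr rfl fun k₁ _ => ?_
    rw [Finset.sum_mul]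
    refine Finset.sum_congr rfl fun k₂ _ => ?_
    rw [Finset.mul_sum]
    refine Finset.sum_congr rfl fun k₃ _ => ?_
    rw [map_mul, conj_latticeMode, latticeMode_add, sub_eq_add_neg, latticeMode_add]
    ring
  rw [this]
  simp only [latticeFourier_sum, latticeFourier_smul]

/-- The top frequency created by the cubic nonlinearity out of frequencies in `[b, a]`. -/
theorem latticeFourier_latticeCubic_top (M : ℕ) [NeZero M] (v : LatticeFun M) {a b : ℤ}
    (ha : a ∈ Finset.Ico (-(M : ℤ)) (M : ℤ)) (hb : b ∈ Finset.Ico (-(M : ℤ)) (M : ℤ))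
    (hab : 3 * (a - b) < 2 * M)
    (hv : ∀ k ∈ Finset.Ico (-(M : ℤ)) (M : ℤ), latticeFourier M v k ≠ 0 → b ≤ k ∧ k ≤ a)
    (hva : latticeFourier M v a ≠ 0) (hvb : latticeFourier M v b ≠ 0) :
    latticeFourier M (latticeCubic v) (2 * a - b) ≠ 0 := by
  set c : ℤ → ℂ := fun k => (2 * Real.pi : ℂ)⁻¹ * latticeFourier M v k with hc
  have hc0 : ∀ k, latticeFourier M v k ≠ 0 → c k ≠ 0 := fun k hk =>
    mul_ne_zero (inv_ne_zero two_pi_ne_zero') hk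
  rw [latticeFourier_latticeCubic M v c (eq_sum_latticeMode M v)]
  -- All `k₁ - k₂ + k₃` lie in `[2b - a, 2a - b]`, of width `3(a - b) < 2M`. So congruence to `2a -
  -- b` is equality, which forces `(a, b, a)`.
  have key : ∀ k₁ ∈ Finset.Ico (-(M : ℤ)) (M : ℤ), ∀ k₂ ∈ Finset.Ico (-(M : ℤ)) (M : ℤ),
      ∀ k₃ ∈ Finset.Ico (-(M : ℤ)) (M : ℤ), ¬ (k₁ = a ∧ k₂ = b ∧ k₃ = a) →
      c k₁ * (starRingEnd ℂ) (c k₂) * c k₃ *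
        latticeFourier M (latticeMode M (k₁ - k₂ + k₃)) (2 * a - b) = 0 := by
    intro k₁ h₁ k₂ h₂ k₃ h₃ hne
    by_contra h
    have n₁ : latticeFourier M v k₁ ≠ 0 := fun h0 => h (by simp [hc, h0])
    have n₂ : latticeFourier M v k₂ ≠ 0 := fun h0 => h (by simp [hc, h0])
    have n₃ : latticeFourier M v k₃ ≠ 0 := fun h0 => h (by simp [hc, h0])
    have b₁ := hv k₁ h₁ n₁
    have b₂ := hv k₂ h₂ n₂
    have b₃ := hv k₃ h₃ n₃
    have hcast : ((k₁ - k₂ + k₃ : ℤ) : ZMod (2 * M)) = ((2 * a - b : ℤ) : ZMod (2 * M)) := by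
      by_contra h'
      exact h (by rw [latticeFourier_latticeMode, if_neg h', mul_zero])
    have := intCast_inj_of_abs_sub_lt (abs_lt.2 ⟨by omega, by omega⟩) hcast
    omega
  rw [Finset.sum_eq_single_of_mem a ha fun k₁ h₁ hk => Finset.sum_eq_zero fun k₂ h₂ =>
      Finset.sum_eq_zero fun k₃ h₃ => key k₁ h₁ k₂ h₂ k₃ h₃ (by tauto),
    Finset.sum_eq_single_of_mem b hb fun k₂ h₂ hk =>
      Finset.sum_eq_zero fun k₃ h₃ => key a ha k₂ h₂ k₃ h₃ (by tauto),
    Finset.sum_eq_single_of_mem a ha fun k₃ h₃ hk => key a ha b hb k₃ h₃ (by tauto)]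
  rw [latticeFourier_latticeMode, if_pos (by congr 1; ring)]
  exact mul_ne_zero (mul_ne_zero (mul_ne_zero (hc0 a hva)
    ((map_ne_zero (starRingEnd ℂ)).2 (hc0 b hvb))) (hc0 a hva)) two_pi_ne_zero'

/-- Provides the local Lipschitz bound for ODE uniqueness. The scalars are real since `|v|² v` is
not holomorphic. -/
theorem contDiff_latticeField (α μ : ℝ) (M : ℕ) [NeZero M] :
    ContDiff ℝ 1 (latticeField α μ M) := by
  rw [contDiff_pi]
  intro j
  have hF : ∀ k : ℤ, ContDiff ℝ 1 fun v : LatticeFun M => latticeFourier M v k := fun k =>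
    ((latticeFourierLin M k).toContinuousLinearMap.restrictScalars ℝ).contDiff
  have hj : ContDiff ℝ 1 fun v : LatticeFun M => v j := contDiff_apply ℝ ℂ j
  have hL : ContDiff ℝ 1 fun v : LatticeFun M => latticeFracLaplacian α M v j := by
    simp only [latticeFracLaplacian, latticeFourierInv]
    exact contDiff_const.mul (ContDiff.sum fun k _ =>
      (contDiff_const.mul (hF k)).mul contDiff_const)
  have hC : ContDiff ℝ 1 fun v : LatticeFun M => latticeCubic v j := by
    simp only [latticeCubic]
    exact (Complex.ofRealCLM.contDiff.comp (hj.norm_sq ℝ)).mul hj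
  exact contDiff_const.mul (hL.add (contDiff_const.mul hC))

theorem latticeField_smul_latticeMode (α μ : ℝ) (M : ℕ) [NeZero M] (c : ℂ) {k : ℤ}
    (hk : k ∈ Finset.Ico (-(M : ℤ)) (M : ℤ)) :
    latticeField α μ M (c • latticeMode M k) =
      (-Complex.I * (latticeSymbol α M k + μ * ((‖c‖ ^ 2 : ℝ) : ℂ)) * c) • latticeMode M k := by
  funext j
  rw [latticeField, latticeFracLaplacian_smul_latticeMode α M c hk, latticeCubic_smul_latticeMode]
  simp only [Pi.smul_apply, smul_eq_mul]
  ring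

theorem hasDerivAt_latticePlaneWave (α μ : ℝ) (M : ℕ) [NeZero M] (c : ℂ) {k : ℤ}
    (hk : k ∈ Finset.Ico (-(M : ℤ)) (M : ℤ)) (t : ℝ) :
    HasDerivAt (fun t : ℝ => (c * Complex.exp (-(Complex.I *
        ((latticeSymbol α M k + μ * ‖c‖ ^ 2 : ℝ) : ℂ) * t))) • latticeMode M k)
      (latticeField α μ M ((c * Complex.exp (-(Complex.I *
        ((latticeSymbol α M k + μ * ‖c‖ ^ 2 : ℝ) : ℂ) * t))) • latticeMode M k)) t := by
  rw [latticeField_smul_latticeMode α μ M _ hk]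
  apply HasDerivAt.smul_const
  set θ : ℝ := latticeSymbol α M k + μ * ‖c‖ ^ 2 with hθ
  have hn : ‖c * Complex.exp (-(Complex.I * (θ : ℂ) * t))‖ = ‖c‖ := by
    have : -(Complex.I * (θ : ℂ) * t) = ((-(θ * t) : ℝ) : ℂ) * Complex.I := by push_cast; ring
    rw [norm_mul, this, Complex.norm_exp_ofReal_mul_I, mul_one]
  have h1 : HasDerivAt (fun t : ℝ => -(Complex.I * (θ : ℂ) * (t : ℂ)))
      (-(Complex.I * (θ : ℂ) * 1)) t :=
    ((Complex.ofRealCLM.hasDerivAt (x := t)).const_mul (Complex.I * (θ : ℂ))).neg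
  convert (h1.cexp.const_mul c) using 1
  rw [hn]
  simp only [hθ]
  push_cast
  ring

/-- Uniqueness runs forwards and backwards from an interior time, since the single-mode state is
first found at an uncontrolled `t₀`. -/
theorem eq_latticePlaneWave_of_eq_at (α μ T : ℝ) (M : ℕ) [NeZero M] {v₀ : LatticeFun M}
    {v : ℝ → LatticeFun M} (hv : IsLatticeSolution α μ T M v₀ v) {k : ℤ}
    (hk : k ∈ Finset.Ico (-(M : ℤ)) (M : ℤ)) (c₀ : ℂ) {t₀ : ℝ} (ht₀ : t₀ ∈ Set.Ioo (-T) T)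
    (h₀ : v t₀ = c₀ • latticeMode M k) :
    ∃ c : ℂ, ∀ t ∈ Set.Icc (-T) T, v t = (c * Complex.exp (-(Complex.I *
        ((latticeSymbol α M k + μ * ‖c‖ ^ 2 : ℝ) : ℂ) * t))) • latticeMode M k := by
  set θ : ℝ := latticeSymbol α M k + μ * ‖c₀‖ ^ 2 with hθ
  -- The amplitude is rotated back from `t₀` to time `0`; the modulus, hence the frequency `θ`, does
  -- not change.
  set c : ℂ := c₀ * Complex.exp (((θ * t₀ : ℝ) : ℂ) * Complex.I) with hc
  have hcn : ‖c‖ = ‖c₀‖ := by rw [hc, norm_mul, Complex.norm_exp_ofReal_mul_I, mul_one]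
  have hvI : ∀ t ∈ Set.Icc (-T) T, HasDerivWithinAt v (latticeField α μ M (v t))
      (Set.Icc (-T) T) t := fun t ht => hasDerivWithinAt_pi.2 fun j => hv.2 t ht j
  have hvc : ContinuousOn v (Set.Icc (-T) T) := fun t ht => (hvI t ht).continuousWithinAt
  set w : ℝ → LatticeFun M := fun t => (c * Complex.exp (-(Complex.I *
        ((latticeSymbol α M k + μ * ‖c‖ ^ 2 : ℝ) : ℂ) * t))) • latticeMode M k with hw
  have hwd : ∀ t, HasDerivAt w (latticeField α μ M (w t)) t :=
    hasDerivAt_latticePlaneWave α μ M c hk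
  have hwc : Continuous w := continuous_iff_continuousAt.2 fun t => (hwd t).continuousAt
  -- The field is only locally Lipschitz, so both trajectories are confined to one compact ball.
  obtain ⟨r₁, hr₁⟩ := ((isCompact_Icc.image_of_continuousOn hvc).isBounded).subset_closedBall 0
  obtain ⟨r₂, hr₂⟩ := ((isCompact_Icc (a := -T) (b := T)).image hwc).isBounded.subset_closedBall 0
  obtain ⟨K, hK⟩ := LocallyLipschitzOn.exists_lipschitzOnWith_of_compact
    (isCompact_closedBall (0 : LatticeFun M) (max r₁ r₂))
    ((contDiff_latticeField α μ M).locallyLipschitz.locallyLipschitzOn)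
  have hsub := Set.Ioo_subset_Icc_self (a := -T) (b := T)
  have := ODE_solution_unique_of_mem_Icc (v := fun _ => latticeField α μ M)
    (s := fun _ => Metric.closedBall (0 : LatticeFun M) (max r₁ r₂)) (K := K) (f := v) (g := w)
    (fun t _ => hK) ht₀ hvc
    (fun t ht => (hvI t (hsub ht)).hasDerivAt (Icc_mem_nhds ht.1 ht.2))
    (fun t ht => Metric.closedBall_subset_closedBall (le_max_left _ _)
      (hr₁ ⟨t, hsub ht, rfl⟩))
    hwc.continuousOn (fun t _ => hwd t)
    (fun t ht => Metric.closedBall_subset_closedBall (le_max_right _ _)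
      (hr₂ ⟨t, hsub ht, rfl⟩)) (by
      rw [h₀, hw]
      simp only [hcn, ← hθ]
      rw [hc, mul_assoc, ← Complex.exp_add]
      push_cast
      ring_nf
      simp)
  exact ⟨c, fun t ht => this ht⟩

theorem eq_smul_latticeMode_of_support (M : ℕ) [NeZero M] (v : LatticeFun M) {k : ℤ}
    (hk : k ∈ Finset.Ico (-(M : ℤ)) (M : ℤ))
    (hv : ∀ l ∈ Finset.Ico (-(M : ℤ)) (M : ℤ), latticeFourier M v l ≠ 0 → l = k) :
    v = ((2 * Real.pi : ℂ)⁻¹ * latticeFourier M v k) • latticeMode M k := by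
  conv_lhs => rw [eq_sum_latticeMode M v]
  refine Finset.sum_eq_single_of_mem k hk fun l hl hlk => ?_
  rw [not_imp_comm.1 (hv l hl) hlk, mul_zero, zero_smul]

theorem hasDerivAt_latticeFourier (α μ T : ℝ) (M : ℕ) {v₀ : LatticeFun M}
    {v : ℝ → LatticeFun M} (hv : IsLatticeSolution α μ T M v₀ v) (k : ℤ) {t : ℝ}
    (ht : t ∈ Set.Ioo (-T) T) [NeZero M] :
    HasDerivAt (fun t => latticeFourier M (v t) k)
      (latticeFourier M (latticeField α μ M (v t)) k) t := by
  have hd : HasDerivAt v (latticeField α μ M (v t)) t :=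
    hasDerivAt_pi.2 fun j => (hv.2 t (Set.Ioo_subset_Icc_self ht) j).hasDerivAt
      (Icc_mem_nhds ht.1 ht.2)
  exact ((latticeFourierLin M k).toContinuousLinearMap.restrictScalars
    ℝ).hasFDerivAt.comp_hasDerivAt t hd

theorem latticeFourier_latticeField (α μ : ℝ) (M : ℕ) [NeZero M] (v : LatticeFun M) {k : ℤ}
    (hk : k ∈ Finset.Ico (-(M : ℤ)) (M : ℤ)) :
    latticeFourier M (latticeField α μ M v) k = -Complex.I *
      (latticeSymbol α M k * latticeFourier M v k + μ * latticeFourier M (latticeCubic v) k) := by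
  have : latticeField α μ M v =
      (-Complex.I) • (latticeFracLaplacian α M v + (μ : ℂ) • latticeCubic v) := rfl
  rw [this, latticeFourier_smul, latticeFourier_add, latticeFourier_smul,
    latticeFourier_latticeFracLaplacian α M v hk]

/-- A lattice solution whose frequencies stay in a band of width less than a third of the Nyquist
band is a plane wave: otherwise the cubic term would feed a frequency outside the band. -/
theorem exists_eq_latticePlaneWave (α μ T K : ℝ) (hμ : μ ≠ 0) (hT : 0 < T) (M : ℕ) [NeZero M]
    (hK : 3 * K < M) {v₀ : LatticeFun M} {v : ℝ → LatticeFun M}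
    (hv : IsLatticeSolution α μ T M v₀ v)
    (hband : ∀ t : ℝ, |t| ≤ T → ∀ k ∈ Finset.Ico (-(M : ℤ)) (M : ℤ),
      latticeFourier M (v t) k ≠ 0 → |(k : ℝ)| ≤ K) :
    ∃ k ∈ Finset.Ico (-(M : ℤ)) (M : ℤ), ∃ c : ℂ, ∀ t ∈ Set.Icc (-T) T,
      v t = (c * Complex.exp (-(Complex.I *
        ((latticeSymbol α M k + μ * ‖c‖ ^ 2 : ℝ) : ℂ) * t))) • latticeMode M k := by
  classical
  have hM : 0 < M := NeZero.pos M
  have hM0 : (0 : ℤ) ∈ Finset.Ico (-(M : ℤ)) (M : ℤ) := by rw [Finset.mem_Ico]; omega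
  -- The maximum is taken over all interior times, so that a frequency above it is absent on a whole
  -- neighbourhood of `t₀`. The minimum `b` is needed at `t₀` only.
  set S := (Finset.Ico (-(M : ℤ)) (M : ℤ)).filter fun k =>
    ∃ t ∈ Set.Ioo (-T) T, latticeFourier M (v t) k ≠ 0 with hS
  rcases S.eq_empty_or_nonempty with hSe | hSn
  · have h0 : (0 : ℝ) ∈ Set.Ioo (-T) T := ⟨by linarith, hT⟩
    refine ⟨0, hM0, eq_latticePlaneWave_of_eq_at α μ T M hv hM0 _ h0
      (eq_smul_latticeMode_of_support M (v 0) hM0 fun l hl hne => ?_)⟩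
    have : l ∈ S := Finset.mem_filter.2 ⟨hl, 0, h0, hne⟩
    simp [hSe] at this
  · obtain ⟨a, haS, hmax⟩ := S.exists_max_image id hSn
    obtain ⟨ha, t₀, ht₀, hat⟩ := Finset.mem_filter.1 haS
    set S₀ := (Finset.Ico (-(M : ℤ)) (M : ℤ)).filter fun k => latticeFourier M (v t₀) k ≠ 0
    obtain ⟨b, hbS, hmin⟩ := S₀.exists_min_image id ⟨a, Finset.mem_filter.2 ⟨ha, hat⟩⟩
    obtain ⟨hb, hbt⟩ := Finset.mem_filter.1 hbS
    have hsupp : ∀ k ∈ Finset.Ico (-(M : ℤ)) (M : ℤ), latticeFourier M (v t₀) k ≠ 0 →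
        b ≤ k ∧ k ≤ a := fun k hk hne =>
      ⟨hmin k (Finset.mem_filter.2 ⟨hk, hne⟩), hmax k (Finset.mem_filter.2 ⟨hk, t₀, ht₀, hne⟩)⟩
    have ht₀' : |t₀| ≤ T := abs_le.2 ⟨ht₀.1.le, ht₀.2.le⟩
    have haK := abs_le.1 (hband t₀ ht₀' a ha hat)
    have hbK := abs_le.1 (hband t₀ ht₀' b hb hbt)
    have hab : 3 * (a - b) < 2 * (M : ℤ) := by
      have : (3 * (a - b) : ℝ) < 2 * M := by linarith [haK.2, hbK.1]
      exact_mod_cast this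
    have h2ab : 2 * a - b < (M : ℤ) := by
      have : (2 * a - b : ℝ) < M := by linarith [haK.2, hbK.1]
      exact_mod_cast this
    have hba : b ≤ a := hmin a (Finset.mem_filter.2 ⟨ha, hat⟩)
    have hba' : b = a := by
      by_contra hne
      have hlt : b < a := lt_of_le_of_ne hba hne
      have hmem : 2 * a - b ∈ Finset.Ico (-(M : ℤ)) (M : ℤ) := by
        rw [Finset.mem_Ico] at ha hb ⊢; omega
      have hzero : ∀ t ∈ Set.Ioo (-T) T, latticeFourier M (v t) (2 * a - b) = 0 := by
        intro t ht
        by_contra h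
        have := hmax _ (Finset.mem_filter.2 ⟨hmem, t, ht, h⟩)
        simp only [id] at this
        omega
      -- The derivative of a locally vanishing coefficient is `0`, yet the equation makes it `-iμ`
      -- times the nonzero cubic coefficient.
      have hd := hasDerivAt_latticeFourier α μ T M hv (2 * a - b) ht₀
      have hd0 : HasDerivAt (fun t => latticeFourier M (v t) (2 * a - b)) 0 t₀ :=
        (hasDerivAt_const t₀ (0 : ℂ)).congr_of_eventuallyEq
          (Filter.eventually_of_mem (Ioo_mem_nhds ht₀.1 ht₀.2) hzero)
      have := hd.unique hd0
      rw [latticeFourier_latticeField α μ M _ hmem, hzero t₀ ht₀, mul_zero, zero_add] at this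
      have hne' := latticeFourier_latticeCubic_top M (v t₀) ha hb hab hsupp hat hbt
      simp [hμ, hne'] at this
    refine ⟨a, ha, eq_latticePlaneWave_of_eq_at α μ T M hv ha _ ht₀
      (eq_smul_latticeMode_of_support M (v t₀) ha fun l hl hne => ?_)⟩
    have := hsupp l hl hne
    omega

/-! ### Continuous representatives of Sobolev functions -/

theorem fourier_torus (k : ℤ) (y : ℝ) :
    fourier k (y : Torus) = Complex.exp (Complex.I * (k : ℂ) * (y : ℂ)) := by
  rw [fourier_coe_apply]
  congr 1
  have := Real.pi_ne_zero
  push_cast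
  field_simp

/-- Fourier coefficients and the `L²` series use the normalised Haar measure, while the hypotheses
use `volume`; they differ by the factor `2π`. -/
theorem ae_volume_of_ae_haar {p : Torus → Prop}
    (h : ∀ᵐ x ∂(AddCircle.haarAddCircle : Measure Torus), p x) : ∀ᵐ x : Torus, p x := by
  rw [AddCircle.volume_eq_smul_haarAddCircle]
  exact Measure.ae_smul_measure h _

theorem ae_haar_of_ae_volume {p : Torus → Prop} (h : ∀ᵐ x : Torus, p x) :
    ∀ᵐ x ∂(AddCircle.haarAddCircle : Measure Torus), p x := by
  rw [AddCircle.volume_eq_smul_haarAddCircle] at h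
  exact (Measure.ae_ennreal_smul_measure_iff
    (ENNReal.ofReal_pos.2 Real.two_pi_pos).ne').1 h

theorem fourierCoeff_sub {f g : Torus → ℂ} (hf : Integrable f AddCircle.haarAddCircle)
    (hg : Integrable g AddCircle.haarAddCircle) (k : ℤ) :
    fourierCoeff (f - g) k = fourierCoeff f k - fourierCoeff g k := by
  simpa [fourierCoeff, -fourier_apply, mul_sub] using
    integral_sub (hf.fourier_smul (-k)) (hg.fourier_smul (-k))

theorem integrable_haar_of_memLp {f : Torus → ℂ} (hf : MemLp f 2 volume) :
    Integrable f AddCircle.haarAddCircle :=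
  (memLp_haarAddCircle_iff.2 hf).integrable one_le_two

theorem torusFourier_sub {f g : Torus → ℂ} (hf : MemLp f 2 volume) (hg : MemLp g 2 volume)
    (k : ℤ) : torusFourier (f - g) k = torusFourier f k - torusFourier g k := by
  rw [torusFourier, fourierCoeff_sub (integrable_haar_of_memLp hf) (integrable_haar_of_memLp hg),
    mul_sub, torusFourier, torusFourier]

theorem norm_torusFourier (f : Torus → ℂ) (k : ℤ) :
    ‖torusFourier f k‖ = 2 * Real.pi * ‖fourierCoeff f k‖ := by
  rw [torusFourier, norm_mul, norm_mul, Complex.norm_real, Complex.norm_ofNat, Real.norm_eq_abs,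
    abs_of_pos Real.pi_pos]

theorem MemHs.sub {s : ℝ} {f g : Torus → ℂ} (hf : MemHs s f) (hg : MemHs s g) :
    MemHs s (f - g) := by
  refine ⟨hf.1.sub hg.1, ?_⟩
  refine Summable.of_nonneg_of_le (fun k => by positivity) (fun k => ?_)
    ((hf.2.add hg.2).mul_left 2)
  rw [torusFourier_sub hf.1 hg.1]
  have h1 := norm_sub_le (torusFourier f k) (torusFourier g k)
  have h2 : ‖torusFourier f k - torusFourier g k‖ ^ 2 ≤
      2 * (‖torusFourier f k‖ ^ 2 + ‖torusFourier g k‖ ^ 2) := by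
    nlinarith [sq_nonneg (‖torusFourier f k‖ - ‖torusFourier g k‖),
      norm_nonneg (torusFourier f k - torusFourier g k)]
  calc (1 + (k : ℝ) ^ 2) ^ s * ‖torusFourier f k - torusFourier g k‖ ^ 2
      ≤ (1 + (k : ℝ) ^ 2) ^ s * (2 * (‖torusFourier f k‖ ^ 2 + ‖torusFourier g k‖ ^ 2)) := by
        gcongr
    _ = _ := by ring

theorem summable_japanese_rpow_neg {s : ℝ} (hs : 1 / 2 < s) :
    Summable fun k : ℤ => (1 + (k : ℝ) ^ 2) ^ (-s) := by
  refine Summable.of_norm_bounded_eventually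
    (Real.summable_abs_int_rpow (b := 2 * s) (by linarith)) ?_
  filter_upwards [(Set.finite_singleton (0 : ℤ)).compl_mem_cofinite] with k hk
  have hk0 : (0 : ℝ) < |(k : ℝ)| := abs_pos.2 (Int.cast_ne_zero.2 hk)
  rw [Real.norm_of_nonneg (by positivity), show -(2 * s) = 2 * -s by ring,
    Real.rpow_mul hk0.le, Real.rpow_two, sq_abs]
  exact Real.rpow_le_rpow_of_nonpos (pow_pos hk0 2 |>.trans_eq (sq_abs _)) (by linarith) (by linarith)

/-- The constant of the embedding of `H^s` into the functions with absolutely summable Fourier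
series. -/
def sobolevConst (s : ℝ) : ℝ := Real.sqrt (∑' k : ℤ, (1 + (k : ℝ) ^ 2) ^ (-s))

/-- Cauchy–Schwarz against the weight `⟨k⟩^{-s}`. The finite form gives both absolute summability
and the bound on the sum. -/
theorem sum_norm_fourierCoeff_le {s : ℝ} (hs : 1 / 2 < s) {f : Torus → ℂ} (hf : MemHs s f)
    (S : Finset ℤ) : ∑ k ∈ S, ‖fourierCoeff f k‖ ≤ sobolevConst s * hsNorm s f := by
  have h2π : 1 ≤ 2 * Real.pi := by linarith [Real.pi_gt_three]
  have hterm : ∀ k : ℤ, ‖fourierCoeff f k‖ =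
      Real.sqrt ((1 + (k : ℝ) ^ 2) ^ (-s)) *
        Real.sqrt ((1 + (k : ℝ) ^ 2) ^ s * ‖fourierCoeff f k‖ ^ 2) := fun k => by
    have hp : (0 : ℝ) < 1 + (k : ℝ) ^ 2 := by positivity
    rw [← Real.sqrt_mul (by positivity), ← mul_assoc, ← Real.rpow_add hp, neg_add_cancel,
      Real.rpow_zero, one_mul, Real.sqrt_sq (norm_nonneg _)]
  rw [Finset.sum_congr rfl fun k _ => hterm k]
  rw [sobolevConst, hsNorm, ← Real.sqrt_mul (tsum_nonneg fun _ => by positivity)]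
  refine Real.le_sqrt_of_sq_le ((Finset.sum_mul_sq_le_sq_mul_sq _ _ _).trans ?_)
  refine mul_le_mul ?_ ?_ (Finset.sum_nonneg fun _ _ => by positivity)
    (tsum_nonneg fun _ => by positivity)
  · rw [Finset.sum_congr rfl fun (k : ℤ) _ => Real.sq_sqrt
      (show 0 ≤ (1 + (k : ℝ) ^ 2) ^ (-s) by positivity)]
    exact (summable_japanese_rpow_neg hs).sum_le_tsum _ fun _ _ => by positivity
  · rw [Finset.sum_congr rfl fun (k : ℤ) _ => Real.sq_sqrt
      (show 0 ≤ (1 + (k : ℝ) ^ 2) ^ s * ‖fourierCoeff f k‖ ^ 2 by positivity)]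
    refine le_trans ?_ (mul_le_mul_of_nonneg_left
      (hf.2.sum_le_tsum S fun _ _ => by positivity) (by positivity))
    rw [Finset.mul_sum]
    refine Finset.sum_le_sum fun k _ => ?_
    rw [norm_torusFourier]
    have : (2 * Real.pi)⁻¹ * ((1 + (k : ℝ) ^ 2) ^ s * (2 * Real.pi * ‖fourierCoeff f k‖) ^ 2) =
        (2 * Real.pi) * ((1 + (k : ℝ) ^ 2) ^ s * ‖fourierCoeff f k‖ ^ 2) := by
      field_simp
    rw [this]
    exact le_mul_of_one_le_left (by positivity) h2π

theorem summable_norm_fourierCoeff {s : ℝ} (hs : 1 / 2 < s) {f : Torus → ℂ} (hf : MemHs s f) :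
    Summable fun k => ‖fourierCoeff f k‖ :=
  summable_of_sum_le (fun _ => norm_nonneg _) (sum_norm_fourierCoeff_le hs hf)

/-- The sum of the Fourier series of `f`, as a continuous function. -/
def fourierSeries (f : Torus → ℂ) : C(Torus, ℂ) := ∑' k : ℤ, fourierCoeff f k • fourier k

theorem summable_fourierSeries {f : Torus → ℂ} (hf : Summable fun k => ‖fourierCoeff f k‖) :
    Summable fun k : ℤ => fourierCoeff f k • (fourier k : C(Torus, ℂ)) := by
  refine Summable.of_norm ?_
  simpa only [norm_smul, fourier_norm, mul_one] using hf

/-- The Fourier series converges to `f` in `L²` and uniformly to `fourierSeries f`; the two limits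
agree in `L²`. -/
theorem ae_eq_fourierSeries {f : Torus → ℂ} (hf : MemLp f 2 volume)
    (hs : Summable fun k => ‖fourierCoeff f k‖) : ∀ᵐ x : Torus, f x = fourierSeries f x := by
  apply ae_volume_of_ae_haar
  have hL := memLp_haarAddCircle_iff.2 hf
  have h1 := hasSum_fourier_series_L2 hL.toLp
  rw [fourierCoeff_congr_ae hL.coeFn_toLp] at h1
  have h2 := (ContinuousMap.toLp (E := ℂ) 2 (AddCircle.haarAddCircle : Measure Torus) ℂ).hasSum
    (summable_fourierSeries hs).hasSum
  have h3 := h1.unique (h2.congr_fun fun k => by simp [fourierLp])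
  filter_upwards [hL.coeFn_toLp, ContinuousMap.coeFn_toLp (𝕜 := ℂ) (p := 2)
    (AddCircle.haarAddCircle : Measure Torus) (fourierSeries f)] with x hx1 hx2
  rw [← hx1, h3, ← hx2]
  rfl

theorem fourierCoeff_fourierSeries {f : Torus → ℂ} (hf : MemLp f 2 volume)
    (hs : Summable fun k => ‖fourierCoeff f k‖) :
    fourierCoeff (fourierSeries f) = fourierCoeff f :=
  (fourierCoeff_congr_ae (ae_haar_of_ae_volume (ae_eq_fourierSeries hf hs))).symm

theorem norm_fourierSeries_sub_le {s : ℝ} (hs : 1 / 2 < s) {f g : Torus → ℂ} (hf : MemHs s f)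
    (hg : MemHs s g) :
    ‖fourierSeries f - fourierSeries g‖ ≤ sobolevConst s * hsNorm s (f - g) := by
  have h1 := summable_fourierSeries (summable_norm_fourierCoeff hs hf)
  have h2 := summable_fourierSeries (summable_norm_fourierCoeff hs hg)
  have hfg := summable_norm_fourierCoeff hs (hf.sub hg)
  rw [fourierSeries, fourierSeries, ← h1.tsum_sub h2]
  have : ∀ k : ℤ, fourierCoeff f k • (fourier k : C(Torus, ℂ)) - fourierCoeff g k • fourier k =
      fourierCoeff (f - g) k • fourier k := fun k => by
    rw [fourierCoeff_sub (integrable_haar_of_memLp hf.1) (integrable_haar_of_memLp hg.1), sub_smul]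
  simp_rw [this]
  refine (norm_tsum_le_tsum_norm (by
    simpa only [norm_smul, fourier_norm, mul_one] using hfg)).trans ?_
  simp_rw [norm_smul, fourier_norm, mul_one]
  exact Real.tsum_le_of_sum_le (fun _ => norm_nonneg _)
    (sum_norm_fourierCoeff_le hs (hf.sub hg))

/-- Upgrades continuity in `H^s` to continuity in the sup norm, where the cubic map is continuous.
-/
theorem continuousOn_fourierSeries {s : ℝ} (hs : 1 / 2 < s) {u : ℝ → Torus → ℂ} {I : Set ℝ}
    (hu : ContinuousInHs s u I) : ContinuousOn (fun t => fourierSeries (u t)) I := by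
  intro t₀ ht₀
  have h0 : Filter.Tendsto (fun t => sobolevConst s * hsNorm s (u t - u t₀)) (𝓝[I] t₀) (𝓝 0) := by
    simpa using (hu.2 t₀ ht₀).const_mul (sobolevConst s)
  rw [ContinuousWithinAt, tendsto_iff_norm_sub_tendsto_zero]
  refine squeeze_zero' (Filter.Eventually.of_forall fun _ => norm_nonneg _) ?_ h0
  filter_upwards [self_mem_nhdsWithin] with t ht
  exact norm_fourierSeries_sub_le hs (hu.1 t ht) (hu.1 t₀ ht₀)

theorem ae_eq_sum_fourier {f : Torus → ℂ} (hf : MemLp f 2 volume) {S : Finset ℤ}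
    (hS : ∀ k, fourierCoeff f k ≠ 0 → k ∈ S) :
    ∀ᵐ x : Torus, f x = ∑ k ∈ S, fourierCoeff f k * fourier k x := by
  have h0 : ∀ k ∉ S, fourierCoeff f k = 0 := fun k hk => not_imp_comm.1 (hS k) hk
  have hs : Summable fun k => ‖fourierCoeff f k‖ :=
    summable_of_ne_finset_zero (s := S) fun k hk => by rw [h0 k hk, norm_zero]
  filter_upwards [ae_eq_fourierSeries hf hs] with x hx
  rw [hx, fourierSeries, tsum_eq_sum (s := S) fun k hk => by rw [h0 k hk, zero_smul],
    ContinuousMap.coe_sum, Finset.sum_apply]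
  rfl

/-! ### Uniqueness for the equation on the circle -/

/-- Grönwall: with `G` the primitive of `e`, the function `G(t) e^{-Kt}` is nonincreasing and starts
at `0`. -/
theorem eq_zero_of_le_mul_integral {e : ℝ → ℝ} (he : Continuous e) (h0 : ∀ t, 0 ≤ e t)
    {K T : ℝ} (hK : ∀ t ∈ Set.Icc 0 T, e t ≤ K * ∫ τ in (0 : ℝ)..t, e τ) :
    ∀ t ∈ Set.Icc 0 T, e t = 0 := by
  set G : ℝ → ℝ := fun t => ∫ τ in (0 : ℝ)..t, e τ with hG
  have hd : ∀ t, HasDerivAt (fun t => G t * Real.exp (-(K * t)))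
      ((e t - K * G t) * Real.exp (-(K * t))) t := fun t => by
    have h1 : HasDerivAt G (e t) t := (he.integral_hasStrictDerivAt 0 t).hasDerivAt
    have h2 : HasDerivAt (fun t : ℝ => -(K * t)) (-(K * 1)) t :=
      ((hasDerivAt_id t).const_mul K).neg
    exact (h1.mul h2.exp).congr_deriv (by ring)
  have hanti : AntitoneOn (fun t => G t * Real.exp (-(K * t))) (Set.Icc 0 T) := by
    refine antitoneOn_of_deriv_nonpos (convex_Icc 0 T)
      (fun t _ => (hd t).continuousAt.continuousWithinAt)
      (fun t _ => (hd t).differentiableAt.differentiableWithinAt) fun t ht => ?_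
    rw [(hd t).deriv]
    exact mul_nonpos_of_nonpos_of_nonneg
      (sub_nonpos.2 (hK t (interior_subset ht))) (Real.exp_pos _).le
  have hG0 : G 0 = 0 := intervalIntegral.integral_same
  intro t ht
  have h1 := hanti ⟨le_rfl, ht.1.trans ht.2⟩ ht ht.1
  simp only [hG0, zero_mul] at h1
  have h2 : G t ≤ 0 := by
    by_contra h
    exact absurd h1 (not_le.2 (mul_pos (not_le.1 h) (Real.exp_pos _)))
  have h3 : 0 ≤ G t := intervalIntegral.integral_nonneg ht.1 fun τ _ => h0 τ
  have h4 := hK t ht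
  have h5 : G t = 0 := le_antisymm h2 h3
  rw [show ∫ τ in (0 : ℝ)..t, e τ = G t from rfl, h5, mul_zero] at h4
  exact le_antisymm h4 (h0 t)

/-- Cauchy–Schwarz in time, from expanding `∫ (t f - m)² ≥ 0` with `m = ∫ f`. -/
theorem sq_intervalIntegral_le {f : ℝ → ℝ} (hf : Continuous f) {t : ℝ} (ht : 0 ≤ t) :
    (∫ τ in (0 : ℝ)..t, f τ) ^ 2 ≤ t * ∫ τ in (0 : ℝ)..t, f τ ^ 2 := by
  rcases ht.eq_or_lt with rfl | ht
  · simp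
  set m := ∫ τ in (0 : ℝ)..t, f τ with hm
  have h1 : 0 ≤ ∫ τ in (0 : ℝ)..t, (t * f τ - m) ^ 2 :=
    intervalIntegral.integral_nonneg ht.le fun τ _ => sq_nonneg _
  have h2 : ∫ τ in (0 : ℝ)..t, (t * f τ - m) ^ 2 =
      t ^ 2 * (∫ τ in (0 : ℝ)..t, f τ ^ 2) - 2 * t * m * m + t * m ^ 2 := by
    have : ∀ τ, (t * f τ - m) ^ 2 = t ^ 2 * f τ ^ 2 - 2 * t * m * f τ + m ^ 2 := fun τ => by ring
    simp_rw [this]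
    rw [intervalIntegral.integral_add, intervalIntegral.integral_sub,
      intervalIntegral.integral_const_mul, intervalIntegral.integral_const_mul,
      intervalIntegral.integral_const, ← hm]
    · simp
    all_goals exact Continuous.intervalIntegrable (by fun_prop) _ _
  rw [h2] at h1
  have h3 : t * m ^ 2 ≤ t * (t * ∫ τ in (0 : ℝ)..t, f τ ^ 2) := by nlinarith
  exact le_of_mul_le_mul_left h3 ht

theorem norm_cubic_sub_le {a b : ℂ} {B : ℝ} (ha : ‖a‖ ≤ B) (hb : ‖b‖ ≤ B) :
    ‖a * (starRingEnd ℂ) a * a - b * (starRingEnd ℂ) b * b‖ ≤ 3 * B ^ 2 * ‖a - b‖ := by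
  have hB : 0 ≤ B := (norm_nonneg a).trans ha
  have h : a * (starRingEnd ℂ) a * a - b * (starRingEnd ℂ) b * b =
      (a - b) * ((starRingEnd ℂ) a * a) + (starRingEnd ℂ) (a - b) * (b * a) +
        (a - b) * (b * (starRingEnd ℂ) b) := by
    rw [map_sub]; ring
  have hn : ∀ x y z : ℂ, ‖y‖ ≤ B → ‖z‖ ≤ B → ‖x * (y * z)‖ ≤ ‖x‖ * B ^ 2 := fun x y z hy hz => by
    rw [norm_mul, norm_mul, sq]
    gcongr
  rw [h]
  refine (norm_add₃_le).trans ?_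
  have h1 := hn (a - b) ((starRingEnd ℂ) a) a (by rwa [Complex.norm_conj]) ha
  have h2 := hn ((starRingEnd ℂ) (a - b)) b a hb ha
  have h3 := hn (a - b) b ((starRingEnd ℂ) b) hb (by rwa [Complex.norm_conj])
  rw [Complex.norm_conj] at h2
  linarith

/-- The nonlinearity `|f|² f` on continuous functions. -/
def torusCubic (f : C(Torus, ℂ)) : C(Torus, ℂ) := f * star f * f

theorem torusCubic_apply (f : C(Torus, ℂ)) (x : Torus) :
    torusCubic f x = f x * (starRingEnd ℂ) (f x) * f x := rfl

theorem continuous_torusCubic : Continuous torusCubic := by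
  unfold torusCubic
  fun_prop

/-- The class in `L²` of a continuous function. -/
def toL2 : C(Torus, ℂ) →L[ℂ] Lp ℂ 2 (AddCircle.haarAddCircle : Measure Torus) :=
  ContinuousMap.toLp (E := ℂ) 2 AddCircle.haarAddCircle ℂ

theorem hasSum_sq_norm_fourierCoeff (f : C(Torus, ℂ)) :
    HasSum (fun k => ‖fourierCoeff f k‖ ^ 2) (‖toL2 f‖ ^ 2) := by
  have h1 : HasSum (fun k => ‖(fourierBasis (T := 2 * Real.pi)).repr (toL2 f) k‖ ^ 2)
      (‖(fourierBasis (T := 2 * Real.pi)).repr (toL2 f)‖ ^ 2) := by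
    apply_mod_cast lp.hasSum_norm ?_ ((fourierBasis (T := 2 * Real.pi)).repr (toL2 f))
    simp
  simp_rw [fourierBasis_repr, LinearIsometryEquiv.norm_map, toL2, fourierCoeff_toLp] at h1
  exact h1

theorem norm_toL2_torusCubic_sub_le {f g : C(Torus, ℂ)} {B : ℝ} (hf : ‖f‖ ≤ B) (hg : ‖g‖ ≤ B) :
    ‖toL2 (torusCubic f - torusCubic g)‖ ≤ 3 * B ^ 2 * ‖toL2 (f - g)‖ := by
  apply Lp.norm_le_mul_norm_of_ae_le_mul
  filter_upwards [ContinuousMap.coeFn_toLp (𝕜 := ℂ) (p := 2)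
    (AddCircle.haarAddCircle : Measure Torus) (torusCubic f - torusCubic g),
    ContinuousMap.coeFn_toLp (𝕜 := ℂ) (p := 2)
    (AddCircle.haarAddCircle : Measure Torus) (f - g)] with x h1 h2
  rw [toL2, h1, h2]
  exact norm_cubic_sub_le ((f.norm_coe_le_norm x).trans hf) ((g.norm_coe_le_norm x).trans hg)

theorem fourierCoeff_continuousMap_sub (f g : C(Torus, ℂ)) (k : ℤ) :
    fourierCoeff (f - g : C(Torus, ℂ)) k = fourierCoeff f k - fourierCoeff g k :=
  fourierCoeff_sub (f.continuous.integrable_of_hasCompactSupport (HasCompactSupport.of_compactSpace f))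
    (g.continuous.integrable_of_hasCompactSupport (HasCompactSupport.of_compactSpace g)) k

theorem norm_fourierCoeff_le (f : C(Torus, ℂ)) (k : ℤ) : ‖fourierCoeff f k‖ ≤ ‖f‖ := by
  rw [fourierCoeff]
  refine (norm_integral_le_of_norm_le_const (C := ‖f‖) (Filter.Eventually.of_forall fun x => ?_)).trans
    (by simp)
  rw [norm_smul, fourier_apply, Circle.norm_coe, one_mul]
  exact f.norm_coe_le_norm x

theorem continuous_fourierCoeff (k : ℤ) : Continuous fun f : C(Torus, ℂ) => fourierCoeff f k := by
  refine LipschitzWith.continuous (K := 1) (LipschitzWith.of_dist_le_mul fun f g => ?_)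
  rw [dist_eq_norm, dist_eq_norm, ← fourierCoeff_continuousMap_sub, NNReal.coe_one, one_mul]
  exact norm_fourierCoeff_le _ _

theorem norm_propagator (α t : ℝ) (k : ℤ) : ‖propagator α t k‖ = 1 := by
  have : -(Complex.I * (t : ℂ) * ((|(k : ℝ)| ^ α : ℝ) : ℂ)) =
      ((-(t * |(k : ℝ)| ^ α) : ℝ) : ℂ) * Complex.I := by push_cast; ring
  rw [propagator, this, Complex.norm_exp_ofReal_mul_I]

theorem continuous_propagator (α : ℝ) (k : ℤ) : Continuous fun t => propagator α t k := by
  unfold propagator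
  fun_prop

/-- `U` solves the Duhamel equation on `[0, T]` with initial Fourier coefficients `a`. -/
def IsDuhamelSolution (α μ T : ℝ) (a : ℤ → ℂ) (U : ℝ → C(Torus, ℂ)) : Prop :=
  ∀ t ∈ Set.Icc 0 T, ∀ k : ℤ, fourierCoeff (U t) k = propagator α t k * a k -
    Complex.I * (μ : ℂ) * ∫ τ in (0 : ℝ)..t,
      propagator α (t - τ) k * fourierCoeff (torusCubic (U τ)) k

/-- The propagator is unimodular, so each mode of the difference is bounded by a time integral.
Parseval and the `L²` Lipschitz bound for the cubic term on sup-norm balls then lead to Grönwall for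
`‖U - V‖²`. -/
theorem IsDuhamelSolution.unique {α μ T : ℝ} {a : ℤ → ℂ} {U V : ℝ → C(Torus, ℂ)}
    (hU : Continuous U) (hV : Continuous V) (dU : IsDuhamelSolution α μ T a U)
    (dV : IsDuhamelSolution α μ T a V) : ∀ t ∈ Set.Icc 0 T, U t = V t := by
  obtain ⟨r₁, hr₁⟩ := ((isCompact_Icc (a := 0) (b := T)).image hU).isBounded.subset_closedBall 0
  obtain ⟨r₂, hr₂⟩ := ((isCompact_Icc (a := 0) (b := T)).image hV).isBounded.subset_closedBall 0
  set B := max r₁ r₂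
  have hUB : ∀ t ∈ Set.Icc 0 T, ‖U t‖ ≤ B := fun t ht =>
    (mem_closedBall_zero_iff.1 (hr₁ ⟨t, ht, rfl⟩)).trans (le_max_left _ _)
  have hVB : ∀ t ∈ Set.Icc 0 T, ‖V t‖ ≤ B := fun t ht =>
    (mem_closedBall_zero_iff.1 (hr₂ ⟨t, ht, rfl⟩)).trans (le_max_right _ _)
  set G : ℝ → C(Torus, ℂ) := fun t => torusCubic (U t) - torusCubic (V t) with hG
  have hGc : Continuous G := (continuous_torusCubic.comp hU).sub (continuous_torusCubic.comp hV)
  have hGk : ∀ k, Continuous fun τ => fourierCoeff (G τ) k := fun k =>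
    (continuous_fourierCoeff k).comp hGc
  have hNG : Continuous fun τ => ‖toL2 (G τ)‖ := (toL2.continuous.comp hGc).norm
  set e : ℝ → ℝ := fun t => ‖toL2 (U t - V t)‖ ^ 2 with he
  have hec : Continuous e := ((toL2.continuous.comp (hU.sub hV)).norm).pow 2
  have hdiff : ∀ t ∈ Set.Icc 0 T, ∀ k, ‖fourierCoeff (U t - V t : C(Torus, ℂ)) k‖ ^ 2 ≤
      μ ^ 2 * (T * ∫ τ in (0 : ℝ)..t, ‖fourierCoeff (G τ) k‖ ^ 2) := by
    intro t ht k
    have hint : ∀ W : ℝ → C(Torus, ℂ), Continuous W → IntervalIntegrable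
        (fun τ => propagator α (t - τ) k * fourierCoeff (torusCubic (W τ)) k) volume 0 t :=
      fun W hW => Continuous.intervalIntegrable
        (((continuous_propagator α k).comp (continuous_const.sub continuous_id)).mul
          ((continuous_fourierCoeff k).comp (continuous_torusCubic.comp hW))) _ _
    have h1 : fourierCoeff (U t - V t : C(Torus, ℂ)) k = -(Complex.I * (μ : ℂ)) *
        ∫ τ in (0 : ℝ)..t, propagator α (t - τ) k * fourierCoeff (G τ) k := by
      rw [fourierCoeff_continuousMap_sub, dU t ht k, dV t ht k]
      simp only [hG, fourierCoeff_continuousMap_sub, mul_sub]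
      rw [intervalIntegral.integral_sub (hint U hU) (hint V hV)]
      ring
    have h2 : ‖∫ τ in (0 : ℝ)..t, propagator α (t - τ) k * fourierCoeff (G τ) k‖ ≤
        ∫ τ in (0 : ℝ)..t, ‖fourierCoeff (G τ) k‖ := by
      refine (intervalIntegral.norm_integral_le_integral_norm ht.1).trans_eq ?_
      simp_rw [norm_mul, norm_propagator, one_mul]
    have h3 := sq_intervalIntegral_le (hGk k).norm ht.1
    have h4 : 0 ≤ ∫ τ in (0 : ℝ)..t, ‖fourierCoeff (G τ) k‖ ^ 2 :=
      intervalIntegral.integral_nonneg ht.1 fun _ _ => by positivity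
    rw [h1, norm_mul, norm_neg, norm_mul, Complex.norm_I, one_mul, Complex.norm_real, mul_pow,
      Real.norm_eq_abs, sq_abs]
    refine mul_le_mul_of_nonneg_left ?_ (sq_nonneg μ)
    calc _ ≤ (∫ τ in (0 : ℝ)..t, ‖fourierCoeff (G τ) k‖) ^ 2 := by gcongr
      _ ≤ _ := h3
      _ ≤ _ := mul_le_mul_of_nonneg_right ht.2 h4
  have hmain : ∀ t ∈ Set.Icc 0 T, e t ≤
      (μ ^ 2 * T * (3 * B ^ 2) ^ 2) * ∫ τ in (0 : ℝ)..t, e τ := by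
    intro t ht
    have hT : 0 ≤ T := ht.1.trans ht.2
    -- Working with finite partial sums avoids exchanging an infinite sum with the time integral.
    refine hasSum_le_of_sum_le (hasSum_sq_norm_fourierCoeff (U t - V t)) fun S => ?_
    have hcS : ∀ k ∈ S, IntervalIntegrable (fun τ => ‖fourierCoeff (G τ) k‖ ^ 2) volume 0 t :=
      fun k _ => ((hGk k).norm.pow 2).intervalIntegrable _ _
    calc ∑ k ∈ S, ‖fourierCoeff (U t - V t : C(Torus, ℂ)) k‖ ^ 2
        ≤ ∑ k ∈ S, μ ^ 2 * (T * ∫ τ in (0 : ℝ)..t, ‖fourierCoeff (G τ) k‖ ^ 2) :=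
          Finset.sum_le_sum fun k _ => hdiff t ht k
      _ = μ ^ 2 * T * ∫ τ in (0 : ℝ)..t, ∑ k ∈ S, ‖fourierCoeff (G τ) k‖ ^ 2 := by
          rw [intervalIntegral.integral_finsetSum hcS, ← Finset.mul_sum, ← Finset.mul_sum]
          ring
      _ ≤ μ ^ 2 * T * ∫ τ in (0 : ℝ)..t, (3 * B ^ 2) ^ 2 * e τ := by
          refine mul_le_mul_of_nonneg_left ?_ (by positivity)
          refine intervalIntegral.integral_mono_on ht.1
            (Continuous.intervalIntegrable
              (continuous_finsetSum _ fun k _ => (hGk k).norm.pow 2) _ _)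
            ((continuous_const.mul hec).intervalIntegrable _ _) fun τ hτ => ?_
          have hτT : τ ∈ Set.Icc 0 T := ⟨hτ.1, hτ.2.trans ht.2⟩
          refine (sum_le_hasSum S (fun _ _ => by positivity)
            (hasSum_sq_norm_fourierCoeff (G τ))).trans ?_
          rw [he, ← mul_pow]
          have := norm_toL2_torusCubic_sub_le (hUB τ hτT) (hVB τ hτT)
          gcongr
      _ = _ := by rw [intervalIntegral.integral_const_mul]; ring
  intro t ht
  have h0 := eq_zero_of_le_mul_integral hec (fun t => by positivity) hmain t ht
  have h1 : toL2 (U t - V t) = toL2 0 := by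
    rw [map_zero]
    exact norm_eq_zero.1 (pow_eq_zero_iff two_ne_zero |>.1 h0)
  exact sub_eq_zero.1 (ContinuousMap.toLp_injective AddCircle.haarAddCircle h1)

/-! ### Plane waves on the circle -/

theorem norm_fourier_apply (k : ℤ) (x : Torus) : ‖(fourier k : C(Torus, ℂ)) x‖ = 1 := by
  rw [fourier_apply, Circle.norm_coe]

theorem torusCubic_smul_fourier (z : ℂ) (k : ℤ) :
    torusCubic (z • (fourier k : C(Torus, ℂ))) = (((‖z‖ ^ 2 : ℝ) : ℂ) * z) • fourier k := by
  ext x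
  rw [torusCubic_apply, ← ofReal_norm_sq_mul]
  simp only [ContinuousMap.smul_apply, smul_eq_mul, norm_mul, norm_fourier_apply, mul_one]
  ring

theorem fourierCoeff_smul_fourier (z : ℂ) (k l : ℤ) :
    fourierCoeff (z • (fourier k : C(Torus, ℂ)) : C(Torus, ℂ)) l = if l = k then z else 0 := by
  rw [ContinuousMap.coe_smul, fourierCoeff.const_smul, fourierCoeff_fourier, Pi.single_apply]
  simp

/-- The plane wave `c e^{i(kx - ωt)}`. -/
def torusPlaneWave (c : ℂ) (ω : ℝ) (k : ℤ) (t : ℝ) : C(Torus, ℂ) :=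
  (c * Complex.exp (-(Complex.I * (ω : ℂ) * t))) • fourier k

theorem norm_exp_neg_I_mul (ω t : ℝ) : ‖Complex.exp (-(Complex.I * (ω : ℂ) * t))‖ = 1 := by
  have : -(Complex.I * (ω : ℂ) * t) = ((-(ω * t) : ℝ) : ℂ) * Complex.I := by push_cast; ring
  rw [this, Complex.norm_exp_ofReal_mul_I]

theorem continuous_torusPlaneWave (c : ℂ) (ω : ℝ) (k : ℤ) : Continuous (torusPlaneWave c ω k) := by
  unfold torusPlaneWave
  fun_prop

/-- On mode `k` the Duhamel integrand, times `-iμ`, is the `τ`-derivative of `c e^{-it|k|^α -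
iμ|c|²τ}`, so the integral is evaluated exactly; other modes vanish. -/
theorem isDuhamelSolution_torusPlaneWave (α μ T : ℝ) (c : ℂ) (k : ℤ) {a : ℤ → ℂ} (hak : a k = c)
    (ha : ∀ l, l ≠ k → a l = 0) :
    IsDuhamelSolution α μ T a (torusPlaneWave c (|(k : ℝ)| ^ α + μ * ‖c‖ ^ 2) k) := by
  intro t _ l
  set ω : ℝ := |(k : ℝ)| ^ α + μ * ‖c‖ ^ 2 with hω
  simp only [torusPlaneWave, torusCubic_smul_fourier, fourierCoeff_smul_fourier, norm_mul,
    norm_exp_neg_I_mul, mul_one]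
  by_cases hl : l = k
  · subst hl
    simp only [if_true, hak]
    set r : ℝ := |(l : ℝ)| ^ α with hr
    have hd : ∀ τ : ℝ, HasDerivAt
        (fun τ : ℝ => c * Complex.exp (-(Complex.I * t * r) - Complex.I * μ * ‖c‖ ^ 2 * τ))
        (-(Complex.I * μ) * (propagator α (t - τ) l *
          (((‖c‖ ^ 2 : ℝ) : ℂ) * (c * Complex.exp (-(Complex.I * (ω : ℂ) * τ)))))) τ := by
      intro τ
      have h1 : HasDerivAt (fun τ : ℝ => -(Complex.I * t * r) - Complex.I * μ * ‖c‖ ^ 2 * (τ : ℂ))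
          (-(Complex.I * μ * ‖c‖ ^ 2 * 1)) τ :=
        ((Complex.ofRealCLM.hasDerivAt (x := τ)).const_mul _).const_sub _
      refine (h1.cexp.const_mul c).congr_deriv ?_
      have h2 : Complex.exp (-(Complex.I * t * r) - Complex.I * μ * ‖c‖ ^ 2 * (τ : ℂ)) =
          propagator α (t - τ) l * Complex.exp (-(Complex.I * (ω : ℂ) * τ)) := by
        rw [propagator, ← Complex.exp_add, hω]
        congr 1
        push_cast
        ring
      rw [h2]
      push_cast
      ring
    have hcont : Continuous fun τ : ℝ => -(Complex.I * (μ : ℂ)) * (propagator α (t - τ) l *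
          (((‖c‖ ^ 2 : ℝ) : ℂ) * (c * Complex.exp (-(Complex.I * (ω : ℂ) * τ))))) := by
      have : Continuous fun τ : ℝ => propagator α (t - τ) l :=
        (continuous_propagator α l).comp (continuous_const.sub continuous_id)
      fun_prop
    have h3 := intervalIntegral.integral_eq_sub_of_hasDerivAt (fun τ _ => hd τ)
      (hcont.intervalIntegrable 0 t)
    rw [intervalIntegral.integral_const_mul] at h3
    have h4 : c * Complex.exp (-(Complex.I * t * r) - Complex.I * μ * ‖c‖ ^ 2 * (t : ℂ)) =
        c * Complex.exp (-(Complex.I * (ω : ℂ) * t)) := by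
      congr 2
      rw [hω]
      push_cast
      ring
    have h5 : c * Complex.exp (-(Complex.I * t * r) - Complex.I * μ * ‖c‖ ^ 2 * ((0 : ℝ) : ℂ)) =
        propagator α t l * c := by
      rw [propagator, mul_comm, ← hr]
      simp
    rw [h4, h5] at h3
    linear_combination -h3
  · simp [hl, ha l hl]

theorem torusFourier_eq_zero_iff (f : Torus → ℂ) (k : ℤ) :
    torusFourier f k = 0 ↔ fourierCoeff f k = 0 := by
  rw [torusFourier, mul_eq_zero, or_iff_right two_pi_ne_zero']

theorem IsTorusSolution.ae_eq_torusPlaneWave {α μ T : ℝ} (hα : 1 < α) {u₀ : Torus → ℂ}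
    {u : ℝ → Torus → ℂ} (hu : IsTorusSolution α μ T u₀ u) {k : ℤ}
    (hk : ∀ l, torusFourier u₀ l ≠ 0 → l = k) {t : ℝ} (ht : t ∈ Set.Icc 0 T) :
    ∀ᵐ x : Torus, u t x = torusPlaneWave (fourierCoeff u₀ k)
      (|(k : ℝ)| ^ α + μ * ‖fourierCoeff u₀ k‖ ^ 2) k t x := by
  have hT : 0 ≤ T := ht.1.trans ht.2
  have hs : 1 / 2 < α / 2 := by linarith
  have hrep : ∀ τ ∈ Set.Icc 0 T, ∀ᵐ x : Torus, u τ x = fourierSeries (u τ) x := fun τ hτ =>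
    ae_eq_fourierSeries (hu.1.1 τ hτ).1 (summable_norm_fourierCoeff hs (hu.1.1 τ hτ))
  -- Freezing time outside `[0, T]` makes the continuous representative continuous on all of `ℝ`.
  set U : ℝ → C(Torus, ℂ) := fun τ => fourierSeries (u (Set.projIcc 0 T hT τ)) with hU
  have hUc : Continuous U := (continuousOn_fourierSeries hs hu.1).comp_continuous
    (continuous_subtype_val.comp continuous_projIcc) fun τ => (Set.projIcc 0 T hT τ).2
  have hUeq : ∀ τ ∈ Set.Icc 0 T, U τ = fourierSeries (u τ) := fun τ hτ => by
    simp only [hU, Set.projIcc_of_mem hT hτ]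
  have hdU : IsDuhamelSolution α μ T (fourierCoeff u₀) U := by
    intro τ hτ l
    have h1 := hu.2 τ hτ l
    have h2 : ∫ σ in (0 : ℝ)..τ, propagator α (τ - σ) l *
          torusFourier (fun x => ((‖u σ x‖ ^ 2 : ℝ) : ℂ) * u σ x) l =
        (2 * Real.pi : ℂ) * ∫ σ in (0 : ℝ)..τ, propagator α (τ - σ) l *
          fourierCoeff (torusCubic (U σ)) l := by
      rw [← intervalIntegral.integral_const_mul]
      refine intervalIntegral.integral_congr fun σ hσ => ?_
      rw [Set.uIcc_of_le hτ.1] at hσ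
      have hσT : σ ∈ Set.Icc 0 T := ⟨hσ.1, hσ.2.trans hτ.2⟩
      have h3 : fourierCoeff (fun x => ((‖u σ x‖ ^ 2 : ℝ) : ℂ) * u σ x) =
          fourierCoeff (torusCubic (U σ)) := by
        apply fourierCoeff_congr_ae
        filter_upwards [ae_haar_of_ae_volume (hrep σ hσT)] with x hx
        rw [torusCubic_apply, ofReal_norm_sq_mul, hUeq σ hσT, hx]
      simp only [torusFourier, h3]
      ring
    rw [h2, torusFourier, torusFourier] at h1
    rw [hUeq τ hτ, fourierCoeff_fourierSeries (hu.1.1 τ hτ).1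
      (summable_norm_fourierCoeff hs (hu.1.1 τ hτ))]
    refine mul_left_cancel₀ two_pi_ne_zero' ?_
    rw [h1]
    ring
  have hdV := isDuhamelSolution_torusPlaneWave α μ T (fourierCoeff u₀ k) k
    (a := fourierCoeff u₀) rfl fun l hl => by
      rw [← torusFourier_eq_zero_iff]
      exact not_imp_comm.1 (hk l) hl
  have h := hdU.unique hUc (continuous_torusPlaneWave _ _ _) hdV t ht
  filter_upwards [hrep t ht] with x hx
  rw [hx, ← hUeq t ht, h]

/-! ### Discretization of trigonometric polynomials -/

theorem discretize_congr_ae (M : ℕ) [NeZero M] {f g : Torus → ℂ}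
    (h : ∀ᵐ x : Torus, f x = g x) : discretize M f = discretize M g := by
  funext j
  rw [discretize, discretize]
  congr 1
  set a := mesh M * j.val
  have hm := mesh_pos M
  refine intervalIntegral.integral_congr_ae ?_
  -- The averaging interval has length `h ≤ π`, so it lies in the period `(a, a + 2π]`, on which the
  -- quotient map preserves measure.
  have h1 := (AddCircle.measurePreserving_mk (2 * Real.pi)
    a).quasiMeasurePreserving.ae_eq_comp h
  have h2 := (ae_restrict_iff' measurableSet_Ioc).1 h1
  filter_upwards [h2] with y hy hya
  rw [Set.uIoc_of_le (by linarith)] at hya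
  refine hy ⟨hya.1, hya.2.trans ?_⟩
  have : mesh M ≤ Real.pi := by
    have hM : (1 : ℝ) ≤ M := by exact_mod_cast NeZero.one_le
    exact div_le_self Real.pi_pos.le hM
  linarith [Real.pi_pos]

/-- The multiplier of `d_h`: the mean of `e^{iky}` over `[0, h]`. -/
def meanMultiplier (M : ℕ) (k : ℤ) : ℂ :=
  (mesh M : ℂ)⁻¹ * ∫ y in (0 : ℝ)..mesh M, Complex.exp (Complex.I * (k : ℂ) * (y : ℂ))

/-- The mean of `e^{iky}` over `[x, x + h]` is `e^{ikx}` times its mean over `[0, h]`. -/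
theorem discretize_sum_fourier (M : ℕ) (S : Finset ℤ) (a : ℤ → ℂ) :
    discretize M (fun x => ∑ k ∈ S, a k * fourier k x) =
      ∑ k ∈ S, (a k * meanMultiplier M k) • latticeMode M k := by
  funext j
  rw [discretize, Finset.sum_apply]
  simp only [fourier_torus]
  rw [intervalIntegral.integral_finsetSum fun k _ =>
    Continuous.intervalIntegrable (by fun_prop) _ _, Finset.mul_sum]
  refine Finset.sum_congr rfl fun k _ => ?_
  have h := intervalIntegral.integral_comp_add_left
    (fun y : ℝ => a k * Complex.exp (Complex.I * (k : ℂ) * (y : ℂ))) (mesh M * j.val)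
    (a := 0) (b := mesh M)
  rw [add_zero] at h
  rw [← h, Pi.smul_apply, smul_eq_mul, meanMultiplier, latticeMode]
  have : ∀ y : ℝ, a k * Complex.exp (Complex.I * (k : ℂ) * ((mesh M * j.val + y : ℝ) : ℂ)) =
      (a k * Complex.exp (Complex.I * (k : ℂ) * ((mesh M : ℂ) * (j.val : ℂ)))) *
        Complex.exp (Complex.I * (k : ℂ) * (y : ℂ)) := fun y => by
    rw [mul_assoc (a k), ← Complex.exp_add]
    push_cast
    ring_nf
  simp_rw [this]
  rw [intervalIntegral.integral_const_mul]
  ring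

theorem latticeFourier_discretize (M : ℕ) [NeZero M] {f : Torus → ℂ} (hf : MemLp f 2 volume)
    (hS : ∀ k, fourierCoeff f k ≠ 0 → k ∈ Finset.Ico (-(M : ℤ)) (M : ℤ)) {l : ℤ}
    (hl : l ∈ Finset.Ico (-(M : ℤ)) (M : ℤ)) :
    latticeFourier M (discretize M f) l =
      (2 * Real.pi : ℂ) * (fourierCoeff f l * meanMultiplier M l) := by
  rw [discretize_congr_ae M (ae_eq_sum_fourier hf hS), discretize_sum_fourier, latticeFourier_sum,
    Finset.sum_eq_single_of_mem l hl]
  · rw [latticeFourier_smul, latticeFourier_latticeMode, if_pos rfl, mul_comm]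
  · intro k hk hkl
    rw [latticeFourier_smul, latticeFourier_latticeMode,
      if_neg fun h => hkl (intCast_injOn_Ico hk hl h), mul_zero]

/-! ### Bounds for the averaging multiplier and the lattice symbol. -/

theorem norm_exp_I_sub_le (a b : ℝ) :
    ‖Complex.exp (Complex.I * (a : ℂ)) - Complex.exp (Complex.I * (b : ℂ))‖ ≤ |a - b| := by
  have : Complex.exp (Complex.I * (a : ℂ)) - Complex.exp (Complex.I * (b : ℂ)) =
      Complex.exp ((b : ℂ) * Complex.I) * (Complex.exp (Complex.I * ((a - b : ℝ) : ℂ)) - 1) := by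
    rw [mul_sub, ← Complex.exp_add, mul_one]
    push_cast
    ring_nf
  rw [this, norm_mul, Complex.norm_exp_ofReal_mul_I, one_mul]
  exact Real.norm_exp_I_mul_ofReal_sub_one_le

theorem norm_meanMultiplier_sub_one_le (M : ℕ) [NeZero M] (k : ℤ) :
    ‖meanMultiplier M k - 1‖ ≤ |(k : ℝ)| * mesh M := by
  have hm := mesh_pos M
  have hmC : (mesh M : ℂ) ≠ 0 := Complex.ofReal_ne_zero.2 hm.ne'
  have h1 : meanMultiplier M k - 1 = (mesh M : ℂ)⁻¹ * ∫ y in (0 : ℝ)..mesh M,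
      (Complex.exp (Complex.I * (k : ℂ) * (y : ℂ)) - 1) := by
    rw [intervalIntegral.integral_sub (Continuous.intervalIntegrable (by fun_prop) _ _)
      (Continuous.intervalIntegrable (by fun_prop) _ _), mul_sub, meanMultiplier]
    simp [hmC]
  have h2 : ‖∫ y in (0 : ℝ)..mesh M, (Complex.exp (Complex.I * (k : ℂ) * (y : ℂ)) - 1)‖ ≤
      (|(k : ℝ)| * mesh M) * |mesh M - 0| := by
    refine intervalIntegral.norm_integral_le_of_norm_le_const fun y hy => ?_
    rw [Set.uIoc_of_le hm.le] at hy
    have h3 := norm_exp_I_sub_le (k * y) 0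
    have h4 : Complex.I * ((k * y : ℝ) : ℂ) = Complex.I * (k : ℂ) * (y : ℂ) := by push_cast; ring
    rw [h4, Complex.ofReal_zero, mul_zero, Complex.exp_zero, sub_zero, abs_mul,
      abs_of_pos hy.1] at h3
    exact h3.trans (mul_le_mul_of_nonneg_left hy.2 (abs_nonneg _))
  rw [h1, norm_mul, norm_inv, Complex.norm_real, Real.norm_of_nonneg hm.le]
  rw [sub_zero, abs_of_pos hm] at h2
  calc (mesh M)⁻¹ * _ ≤ (mesh M)⁻¹ * ((|(k : ℝ)| * mesh M) * mesh M) := by gcongr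
    _ = _ := by field_simp

theorem meanMultiplier_ne_zero (M : ℕ) [NeZero M] {k : ℤ} (hk : |(k : ℝ)| * mesh M < 1) :
    meanMultiplier M k ≠ 0 := by
  intro h
  have := norm_meanMultiplier_sub_one_le M k
  rw [h, zero_sub, norm_neg, norm_one] at this
  linarith

theorem norm_meanMultiplier (M : ℕ) [NeZero M] {k : ℤ} (hk : k ≠ 0) :
    ‖meanMultiplier M k‖ = |Real.sin (mesh M * k / 2)| / (|(k : ℝ)| * mesh M / 2) := by
  have hm := mesh_pos M
  have hk' : (Complex.I * (k : ℂ)) ≠ 0 := mul_ne_zero Complex.I_ne_zero (Int.cast_ne_zero.2 hk)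
  have hk0 : (0 : ℝ) < |(k : ℝ)| := abs_pos.2 (Int.cast_ne_zero.2 hk)
  rw [meanMultiplier, integral_exp_mul_complex hk', Complex.ofReal_zero, mul_zero, Complex.exp_zero]
  have h1 : Complex.I * (k : ℂ) * (mesh M : ℂ) = Complex.I * ((mesh M * k : ℝ) : ℂ) := by
    push_cast; ring
  rw [h1, norm_mul, norm_div, Complex.norm_exp_I_mul_ofReal_sub_one, norm_mul, norm_mul,
    norm_inv, Complex.norm_I, Complex.norm_real, Real.norm_of_nonneg hm.le, Complex.norm_intCast,
    Real.norm_eq_abs, Real.norm_eq_abs, abs_two]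
  field_simp

/-- Both the symbol and the averaging multiplier come from the factor `|sin(hk/2)| / (h|k|/2)`, so
one bound controls both. -/
theorem latticeSymbol_eq (α : ℝ) (M : ℕ) [NeZero M] {k : ℤ} (hk : k ≠ 0) :
    latticeSymbol α M k = |(k : ℝ)| ^ α * ‖meanMultiplier M k‖ ^ α := by
  have hm := mesh_pos M
  have hk0 : (0 : ℝ) < |(k : ℝ)| := abs_pos.2 (Int.cast_ne_zero.2 hk)
  rw [latticeSymbol, ← Real.mul_rpow hk0.le (norm_nonneg _), norm_meanMultiplier M hk, abs_mul,
    abs_of_pos (div_pos two_pos hm)]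
  congr 1
  field_simp

theorem norm_meanMultiplier_bounds (M : ℕ) [NeZero M] {k : ℤ} (hk : |(k : ℝ)| * mesh M ≤ 1) :
    0 < ‖meanMultiplier M k‖ ∧ ‖meanMultiplier M k‖ ≤ 1 ∧
      1 - ‖meanMultiplier M k‖ ^ 2 ≤ (|(k : ℝ)| * mesh M) ^ 2 := by
  have hm := mesh_pos M
  rcases eq_or_ne k 0 with rfl | hk0
  · have : meanMultiplier M 0 = 1 := by
      have hmC : (mesh M : ℂ) ≠ 0 := Complex.ofReal_ne_zero.2 hm.ne'
      simp [meanMultiplier, hmC]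
    simp [this]
  have hkp : (0 : ℝ) < |(k : ℝ)| := abs_pos.2 (Int.cast_ne_zero.2 hk0)
  set x := |(k : ℝ)| * mesh M / 2 with hx
  have hx0 : 0 < x := by positivity
  have hx1 : x ≤ 1 / 2 := by linarith
  have hsin : |Real.sin (mesh M * k / 2)| = Real.sin x := by
    have h1 : |mesh M * k / 2| = x := by
      rw [abs_div, abs_mul, abs_of_pos hm, abs_two, hx, mul_comm]
    rw [← h1, Real.abs_sin_eq_sin_abs_of_abs_le_pi]
    rw [h1]
    linarith [Real.pi_gt_three]
  rw [norm_meanMultiplier M hk0, hsin, ← hx]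
  -- From `sin x > x - x³/6`. The defect `1 - (sin x / x)²` is then at most `x²/3`, well below the
  -- claimed `(2x)²`.
  have hlow : 1 - x ^ 2 / 6 ≤ Real.sin x / x := by
    rw [le_div_iff₀ hx0]
    have := Real.sin_gt_sub_cube hx0
    nlinarith
  have hup : Real.sin x / x ≤ 1 := (div_le_one hx0).2 (Real.sin_le hx0.le)
  have hx2 : |(k : ℝ)| * mesh M = 2 * x := by rw [hx]; ring
  refine ⟨by nlinarith, hup, ?_⟩
  rw [hx2]
  nlinarith

/-- With `s = ‖meanMultiplier M k‖ ∈ (0, 1]` and `α ≤ 2`, one has `s² ≤ s^α ≤ 1`, so the defect of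
`s^α` is at most that of `s²`. -/
theorem abs_latticeSymbol_sub_le {α : ℝ} (hα : 0 < α) (hα2 : α ≤ 2) (M : ℕ) [NeZero M] {k : ℤ}
    (hk : |(k : ℝ)| * mesh M ≤ 1) :
    |latticeSymbol α M k - |(k : ℝ)| ^ α| ≤ |(k : ℝ)| ^ α * (|(k : ℝ)| * mesh M) ^ 2 := by
  rcases eq_or_ne k 0 with rfl | hk0
  · simp [latticeSymbol, Real.zero_rpow hα.ne']
  obtain ⟨h0, h1, h2⟩ := norm_meanMultiplier_bounds M hk
  rw [latticeSymbol_eq α M hk0]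
  set s := ‖meanMultiplier M k‖
  have h3 : s ^ α ≤ 1 := Real.rpow_le_one h0.le h1 hα.le
  have h4 : s ^ 2 ≤ s ^ α := by
    rw [← Real.rpow_two]
    exact Real.rpow_le_rpow_of_exponent_ge h0 h1 hα2
  have h5 : 0 ≤ |(k : ℝ)| ^ α := by positivity
  rw [show |(k : ℝ)| ^ α * s ^ α - |(k : ℝ)| ^ α = -(|(k : ℝ)| ^ α * (1 - s ^ α)) by ring, abs_neg,
    abs_of_nonneg (mul_nonneg h5 (by linarith))]
  exact mul_le_mul_of_nonneg_left (by linarith) h5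

/-! ### Error estimate -/

/-- The interpolant is a convex combination of `e^{ikz}` at two points `z` within `h` of `y`.
Wrap-around at `π` is harmless, since `latticeMode_intCast` holds for every integer index. -/
theorem norm_interpolate_latticeMode_sub_le (M : ℕ) [NeZero M] (k : ℤ) (x : Torus) :
    ‖interpolate M (latticeMode M k) x - fourier k x‖ ≤ |(k : ℝ)| * mesh M := by
  have hm := mesh_pos M
  have hmC : (mesh M : ℂ) ≠ 0 := Complex.ofReal_ne_zero.2 hm.ne'
  set y : ℝ := (AddCircle.equivIco (2 * Real.pi) (-Real.pi) x : ℝ) with hy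
  set j : ℤ := ⌊y / mesh M⌋ with hj
  have hxy : x = (y : Torus) := AddCircle.coe_equivIco.symm
  have h1 : mesh M * j ≤ y := by
    have := Int.floor_le (y / mesh M)
    rw [le_div_iff₀ hm] at this
    linarith
  have h2 : y ≤ mesh M * j + mesh M := by
    have := (Int.lt_floor_add_one (y / mesh M)).le
    rw [div_le_iff₀ hm] at this
    linarith
  set s : ℝ := (y - mesh M * j) / mesh M with hs
  have hs0 : 0 ≤ s := div_nonneg (by linarith) hm.le
  have hs1 : s ≤ 1 := (div_le_one hm).2 (by linarith)
  have hint : interpolate M (latticeMode M k) x =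
      (((1 - s : ℝ) : ℂ)) * Complex.exp (Complex.I * ((k * (mesh M * j) : ℝ) : ℂ)) +
        (s : ℂ) * Complex.exp (Complex.I * ((k * (mesh M * j + mesh M) : ℝ) : ℂ)) := by
    simp only [interpolate]
    rw [← hy, ← hj, latticeMode_intCast, latticeMode_intCast]
    have e1 : Complex.I * (k : ℂ) * ((mesh M : ℂ) * (j : ℂ)) =
        Complex.I * ((k * (mesh M * j) : ℝ) : ℂ) := by push_cast; ring
    have e2 : Complex.I * (k : ℂ) * ((mesh M : ℂ) * ((j + 1 : ℤ) : ℂ)) =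
        Complex.I * ((k * (mesh M * j + mesh M) : ℝ) : ℂ) := by push_cast; ring
    rw [e1, e2, hs]
    push_cast
    field_simp
    ring
  have hf : fourier k x = Complex.exp (Complex.I * ((k * y : ℝ) : ℂ)) := by
    rw [hxy, fourier_torus]
    push_cast
    ring_nf
  have hsplit : interpolate M (latticeMode M k) x - fourier k x =
      (((1 - s : ℝ) : ℂ)) * (Complex.exp (Complex.I * ((k * (mesh M * j) : ℝ) : ℂ)) -
        Complex.exp (Complex.I * ((k * y : ℝ) : ℂ))) +
      (s : ℂ) * (Complex.exp (Complex.I * ((k * (mesh M * j + mesh M) : ℝ) : ℂ)) -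
        Complex.exp (Complex.I * ((k * y : ℝ) : ℂ))) := by
    rw [hint, hf]
    push_cast
    ring
  have hb : ∀ z : ℝ, |z - y| ≤ mesh M → ‖Complex.exp (Complex.I * ((k * z : ℝ) : ℂ)) -
      Complex.exp (Complex.I * ((k * y : ℝ) : ℂ))‖ ≤ |(k : ℝ)| * mesh M := fun z hz => by
    refine (norm_exp_I_sub_le _ _).trans ?_
    rw [← mul_sub, abs_mul]
    gcongr
  have b1 := hb (mesh M * j) (abs_le.2 ⟨by linarith, by linarith⟩)
  have b2 := hb (mesh M * j + mesh M) (abs_le.2 ⟨by linarith, by linarith⟩)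
  rw [hsplit]
  refine (norm_add_le _ _).trans ?_
  rw [norm_mul, norm_mul, Complex.norm_real, Complex.norm_real, Real.norm_of_nonneg hs0,
    Real.norm_of_nonneg (by linarith : 0 ≤ 1 - s)]
  calc _ ≤ (1 - s) * (|(k : ℝ)| * mesh M) + s * (|(k : ℝ)| * mesh M) :=
        add_le_add (mul_le_mul_of_nonneg_left b1 (by linarith)) (mul_le_mul_of_nonneg_left b2 hs0)
    _ = _ := by ring

theorem interpolate_smul (M : ℕ) (z : ℂ) (g : LatticeFun M) (x : Torus) :
    interpolate M (z • g) x = z * interpolate M g x := by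
  simp only [interpolate, Pi.smul_apply, smul_eq_mul]
  ring

/-- One term of the norm, whose weight `(1 + k²)^s` dominates both `1` and `|k|^{2s}`. -/
theorem norm_fourierCoeff_mul_rpow_le_hsNorm {s : ℝ} (hs : 0 ≤ s) {f : Torus → ℂ}
    (hf : MemHs s f) (k : ℤ) :
    ‖fourierCoeff f k‖ ≤ hsNorm s f ∧ |(k : ℝ)| ^ s * ‖fourierCoeff f k‖ ≤ hsNorm s f := by
  have h2π : 1 ≤ 2 * Real.pi := by linarith [Real.pi_gt_three]
  have h1 : (1 + (k : ℝ) ^ 2) ^ s * ‖fourierCoeff f k‖ ^ 2 ≤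
      (2 * Real.pi)⁻¹ * ∑' k : ℤ, (1 + (k : ℝ) ^ 2) ^ s * ‖torusFourier f k‖ ^ 2 := by
    refine le_trans ?_ (mul_le_mul_of_nonneg_left
      (hf.2.le_tsum k fun _ _ => by positivity) (by positivity))
    rw [norm_torusFourier]
    have : (2 * Real.pi)⁻¹ * ((1 + (k : ℝ) ^ 2) ^ s * (2 * Real.pi * ‖fourierCoeff f k‖) ^ 2) =
        (2 * Real.pi) * ((1 + (k : ℝ) ^ 2) ^ s * ‖fourierCoeff f k‖ ^ 2) := by
      field_simp
    rw [this]
    exact le_mul_of_one_le_left (by positivity) h2π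
  constructor
  · refine Real.le_sqrt_of_sq_le (le_trans ?_ h1)
    exact le_mul_of_one_le_left (by positivity)
      (Real.one_le_rpow (by linarith [sq_nonneg (k : ℝ)]) hs)
  · refine Real.le_sqrt_of_sq_le (le_trans ?_ h1)
    rw [mul_pow, ← Real.rpow_mul_natCast (abs_nonneg _), mul_comm s, Real.rpow_mul (abs_nonneg _),
      Real.rpow_natCast, sq_abs]
    gcongr
    linarith

theorem norm_exp_neg_I_mul_sub_le (ω₁ ω₂ : ℝ) {t : ℝ} (ht : 0 ≤ t) :
    ‖Complex.exp (-(Complex.I * (ω₁ : ℂ) * t)) - Complex.exp (-(Complex.I * (ω₂ : ℂ) * t))‖ ≤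
      t * |ω₁ - ω₂| := by
  have h : ∀ ω : ℝ, -(Complex.I * (ω : ℂ) * t) = Complex.I * ((-(ω * t) : ℝ) : ℂ) := fun ω => by
    push_cast; ring
  rw [h, h]
  refine (norm_exp_I_sub_le _ _).trans_eq ?_
  rw [show -(ω₁ * t) - -(ω₂ * t) = -(t * (ω₁ - ω₂)) by ring, abs_neg, abs_mul, abs_of_nonneg ht]

theorem norm_interpolate_planeWave_sub_le {α μ : ℝ} (hα : 0 < α) (hα2 : α ≤ 2) (hμ : |μ| = 1)
    (M : ℕ) [NeZero M] {k : ℤ} (hk : |(k : ℝ)| * mesh M ≤ 1) (c : ℂ) {t : ℝ} (ht : 0 ≤ t)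
    (x : Torus) :
    ‖interpolate M ((c * meanMultiplier M k * Complex.exp (-(Complex.I *
        ((latticeSymbol α M k + μ * ‖c * meanMultiplier M k‖ ^ 2 : ℝ) : ℂ) * t))) •
          latticeMode M k) x - torusPlaneWave c (|(k : ℝ)| ^ α + μ * ‖c‖ ^ 2) k t x‖ ≤
      ‖c‖ * (2 * (|(k : ℝ)| * mesh M) +
        t * ((|(k : ℝ)| ^ α + ‖c‖ ^ 2) * (|(k : ℝ)| * mesh M) ^ 2)) := by
  set m := meanMultiplier M k with hm
  set ω₁ : ℝ := latticeSymbol α M k + μ * ‖c * m‖ ^ 2 with hω₁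
  set ω₂ : ℝ := |(k : ℝ)| ^ α + μ * ‖c‖ ^ 2 with hω₂
  set δ := |(k : ℝ)| * mesh M with hδ
  obtain ⟨-, hm1, hm2⟩ := norm_meanMultiplier_bounds M hk
  rw [← hm] at hm1 hm2
  rw [← hδ] at hm2
  have hω : |ω₁ - ω₂| ≤ (|(k : ℝ)| ^ α + ‖c‖ ^ 2) * δ ^ 2 := by
    have e : ω₁ - ω₂ = (latticeSymbol α M k - |(k : ℝ)| ^ α) + -(μ * (‖c‖ ^ 2 * (1 - ‖m‖ ^ 2))) := by
      rw [hω₁, hω₂, norm_mul]; ring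
    have h1 := abs_latticeSymbol_sub_le hα hα2 M hk
    have h2 : |-(μ * (‖c‖ ^ 2 * (1 - ‖m‖ ^ 2)))| ≤ ‖c‖ ^ 2 * δ ^ 2 := by
      have h3 : 0 ≤ 1 - ‖m‖ ^ 2 := by
        have := pow_le_one₀ (norm_nonneg m) hm1 (n := 2)
        linarith
      rw [abs_neg, abs_mul, hμ, one_mul, abs_of_nonneg (mul_nonneg (sq_nonneg _) h3)]
      gcongr
    rw [e, add_mul]
    exact (abs_add_le _ _).trans (add_le_add h1 h2)
  set z₁ := Complex.exp (-(Complex.I * (ω₁ : ℂ) * t)) with hz₁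
  set z₂ := Complex.exp (-(Complex.I * (ω₂ : ℂ) * t)) with hz₂
  have hz₁n : ‖z₁‖ = 1 := norm_exp_neg_I_mul ω₁ t
  have hz₂n : ‖z₂‖ = 1 := norm_exp_neg_I_mul ω₂ t
  have hz : ‖z₁ - z₂‖ ≤ t * |ω₁ - ω₂| := norm_exp_neg_I_mul_sub_le ω₁ ω₂ ht
  have hp := norm_interpolate_latticeMode_sub_le M k x
  have hm3 := norm_meanMultiplier_sub_one_le M k
  rw [← hδ] at hp hm3
  rw [← hm] at hm3
  rw [interpolate_smul]
  set p := interpolate M (latticeMode M k) x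
  -- The three summands are the interpolation, amplitude and phase errors.
  have e : c * m * z₁ * p - torusPlaneWave c ω₂ k t x =
      c * (m * (z₁ * (p - fourier k x)) + fourier k x * (z₂ * (m - 1)) +
        fourier k x * (m * (z₁ - z₂))) := by
    simp only [torusPlaneWave, ContinuousMap.smul_apply, smul_eq_mul, ← hz₂]
    ring
  rw [e, norm_mul]
  refine mul_le_mul_of_nonneg_left ?_ (norm_nonneg c)
  refine norm_add₃_le.trans ?_
  simp only [norm_mul, norm_fourier_apply, hz₁n, hz₂n, one_mul]
  have h1 : ‖m‖ * ‖p - fourier k x‖ ≤ δ :=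
    (mul_le_of_le_one_left (norm_nonneg _) hm1).trans hp
  have h2 : ‖m‖ * ‖z₁ - z₂‖ ≤ t * ((|(k : ℝ)| ^ α + ‖c‖ ^ 2) * δ ^ 2) :=
    ((mul_le_of_le_one_left (norm_nonneg _) hm1).trans hz).trans
      (mul_le_mul_of_nonneg_left hω ht)
  linarith

/-- The condition `T h K^{1+α} ≤ 1` trades the growing factor `T` for one power of `|k|h`; then `|k|
= |k|^{α/2} |k|^{1-α/2}` lets the Sobolev bound absorb `|k|^{α/2}`. -/
theorem planeWave_error_le {α R T K h t : ℝ} {k : ℤ} {c : ℂ} (hα : 1 < α) (hα2 : α ≤ 2)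
    (hh : 0 < h) (hkK : |(k : ℝ)| ≤ K) (hc : ‖c‖ ≤ R) (hck : |(k : ℝ)| ^ (α / 2) * ‖c‖ ≤ R)
    (htT : t ≤ T) (hT : 0 ≤ T) (hTK : h * (T * K ^ (1 + α)) ≤ 1) :
    ‖c‖ * (2 * (|(k : ℝ)| * h) + t * ((|(k : ℝ)| ^ α + ‖c‖ ^ 2) * (|(k : ℝ)| * h) ^ 2)) ≤
      (3 + R ^ 2) * R * (h * K ^ (1 - α / 2)) := by
  have hR : 0 ≤ R := (norm_nonneg c).trans hc
  have hK0 : 0 ≤ K := (abs_nonneg _).trans hkK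
  rcases eq_or_ne k 0 with rfl | hk0
  · simp only [Int.cast_zero, abs_zero, zero_mul, mul_zero, ne_eq, OfNat.ofNat_ne_zero,
      not_false_eq_true, zero_pow, add_zero]
    positivity
  set a := |(k : ℝ)| with ha
  have ha1 : 1 ≤ a := by
    rw [ha, ← Int.cast_abs]
    exact_mod_cast Int.one_le_abs hk0
  have ha0 : 0 < a := by linarith
  have hTa : T * h * a ^ (1 + α) ≤ 1 := by
    refine le_trans ?_ hTK
    rw [← mul_assoc, mul_comm h T]
    gcongr
  have haα : a ^ (1 + α) = a * a ^ α := by rw [Real.rpow_add ha0, Real.rpow_one]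
  have ha1α : 1 ≤ a ^ α := Real.one_le_rpow ha1 (by linarith)
  have h1 : T * (a ^ α * (a * h) ^ 2) ≤ a * h := by
    calc T * (a ^ α * (a * h) ^ 2) = (T * h * a ^ (1 + α)) * (a * h) := by rw [haα]; ring
      _ ≤ 1 * (a * h) := by gcongr
      _ = a * h := one_mul _
  -- Since `|k| ≥ 1`, the factor `1 ≤ |k|^α` reduces the nonlinear phase error to the dispersive
  -- one.
  have h2 : T * (‖c‖ ^ 2 * (a * h) ^ 2) ≤ R ^ 2 * (a * h) := by
    calc T * (‖c‖ ^ 2 * (a * h) ^ 2) = ‖c‖ ^ 2 * (T * (1 * (a * h) ^ 2)) := by ring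
      _ ≤ R ^ 2 * (T * (a ^ α * (a * h) ^ 2)) := by gcongr
      _ ≤ R ^ 2 * (a * h) := by gcongr
  have h3 : t * ((a ^ α + ‖c‖ ^ 2) * (a * h) ^ 2) ≤ (1 + R ^ 2) * (a * h) := by
    calc t * ((a ^ α + ‖c‖ ^ 2) * (a * h) ^ 2) ≤ T * ((a ^ α + ‖c‖ ^ 2) * (a * h) ^ 2) := by gcongr
      _ = T * (a ^ α * (a * h) ^ 2) + T * (‖c‖ ^ 2 * (a * h) ^ 2) := by ring
      _ ≤ _ := by linarith
  have haa : a = a ^ (α / 2) * a ^ (1 - α / 2) := by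
    rw [← Real.rpow_add ha0, add_sub_cancel, Real.rpow_one]
  calc ‖c‖ * (2 * (a * h) + t * ((a ^ α + ‖c‖ ^ 2) * (a * h) ^ 2))
      ≤ ‖c‖ * (2 * (a * h) + (1 + R ^ 2) * (a * h)) := by gcongr
    _ = (3 + R ^ 2) * h * (a * ‖c‖) := by ring
    _ = (3 + R ^ 2) * h * ((a ^ (α / 2) * ‖c‖) * a ^ (1 - α / 2)) := by
        conv_lhs => rw [haa]
        ring
    _ ≤ (3 + R ^ 2) * h * (R * K ^ (1 - α / 2)) := by
        have : 0 ≤ 1 - α / 2 := by linarith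
        gcongr
    _ = _ := by ring

theorem abs_le_maxFreq {f : Torus → ℂ} (hf : (Function.support (torusFourier f)).Finite) {k : ℤ}
    (hk : torusFourier f k ≠ 0) : |(k : ℝ)| ≤ maxFreq f :=
  le_csSup (hf.image _).bddAbove ⟨k, hk, rfl⟩

/-- The sharp factor `√(2π)` is replaced by the cruder `2π`. -/
theorem eLpNorm_two_torus_le {f : Torus → ℂ} {D : ℝ} (hf : ∀ᵐ x : Torus, ‖f x‖ ≤ D) :
    eLpNorm f 2 volume ≤ ENNReal.ofReal (2 * Real.pi * D) := by
  have h2π : 1 ≤ 2 * Real.pi := by linarith [Real.pi_gt_three]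
  refine (eLpNorm_le_of_ae_bound hf).trans ?_
  rw [AddCircle.measure_univ, ENNReal.ofReal_mul (p := 2 * Real.pi) (q := D) (by positivity)]
  gcongr
  calc ENNReal.ofReal (2 * Real.pi) ^ ((2 : ENNReal).toReal⁻¹)
      ≤ ENNReal.ofReal (2 * Real.pi) ^ (1 : ℝ) := by
        apply ENNReal.rpow_le_rpow_of_exponent_le
        · exact ENNReal.one_le_ofReal.2 h2π
        · norm_num
    _ = _ := ENNReal.rpow_one _

end FracDNLS

end

theorem mainTheorem9 (α : ℝ) (hα : 1 < α) (hα2 : α ≤ 2) (R : ℝ) :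
    ∃ C₀ > (0 : ℝ), ∃ C > (0 : ℝ),
      ∀ (μ : ℝ) (_ : μ = 1 ∨ μ = -1)
        (u₀ : FracDNLS.Torus → ℂ) (_ : FracDNLS.MemHs (α / 2) u₀)
        (_ : FracDNLS.hsNorm (α / 2) u₀ ≤ R)
        (_ : (Function.support (FracDNLS.torusFourier u₀)).Finite)
        (T k_c h₀ : ℝ) (_ : 0 < T) (_ : 0 < k_c) (_ : 0 < h₀)
        (u : ℝ → FracDNLS.Torus → ℂ) (_ : FracDNLS.IsTorusSolution α μ T u₀ u)
        (u_h : (M : ℕ) → ℝ → FracDNLS.LatticeFun M)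
        (_ : ∀ M : ℕ, 1 ≤ M → FracDNLS.mesh M < h₀ →
          FracDNLS.IsLatticeSolution α μ T M (FracDNLS.discretize M u₀) (u_h M))
        (_ : ∀ M : ℕ, 1 ≤ M → FracDNLS.mesh M < h₀ → ∀ t : ℝ, |t| ≤ T →
          ∀ k ∈ Finset.Ico (-(M : ℤ)) (M : ℤ),
            FracDNLS.latticeFourier M (u_h M t) k ≠ 0 → |(k : ℝ)| ≤ k_c)
        (k_max : ℝ) (_ : k_max = max (FracDNLS.maxFreq u₀) k_c)
        (M : ℕ) (_ : 1 ≤ M)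
        (_ : FracDNLS.mesh M < C₀ * min h₀ (min (3 * k_max)⁻¹
          (min (T * k_max ^ (1 + α))⁻¹ (T ^ 2 * k_max ^ (1 + α))⁻¹)))
        (t : ℝ) (_ : t ∈ Set.Icc 0 T),
        MeasureTheory.eLpNorm (fun x => FracDNLS.interpolate M (u_h M t) x - u t x) 2
            MeasureTheory.volume
          ≤ ENNReal.ofReal (C * FracDNLS.mesh M * k_max ^ (1 - α / 2)) := by
  open FracDNLS in
  -- `2π` comes from passing from sup norm to `L²`; `|R| + 1` replaces `R` so that the constant is
  -- positive for every real `R`.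
  refine ⟨1, one_pos, 2 * Real.pi * ((3 + R ^ 2) * (|R| + 1)), by positivity, ?_⟩
  intro μ hμ u₀ hu₀ hR hfin T k_c h₀ hT hkc hh₀ u hu u_h hsol hband K hK M hM hmesh t ht
  have : NeZero M := ⟨by omega⟩
  have hm := mesh_pos M
  have hKpos : 0 < K := hK ▸ lt_max_of_lt_right hkc
  have hkcK : k_c ≤ K := hK ▸ le_max_right _ _
  have hμ1 : |μ| = 1 := by rcases hμ with rfl | rfl <;> simp
  have hμ0 : μ ≠ 0 := by rcases hμ with rfl | rfl <;> norm_num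
  rw [one_mul, lt_min_iff, lt_min_iff, lt_min_iff] at hmesh
  obtain ⟨hmh₀, hm3, hmT, -⟩ := hmesh
  rw [← one_div, lt_div_iff₀ (by positivity)] at hm3 hmT
  -- From `3Kh < 1 < π = hM`.
  have h3K : 3 * K < M := by
    refine lt_of_mul_lt_mul_left (a := mesh M) ?_ hm.le
    rw [mesh_mul]
    linarith [Real.pi_gt_three]
  have hsuppK : ∀ k, torusFourier u₀ k ≠ 0 → |(k : ℝ)| ≤ K := fun k hk =>
    (abs_le_maxFreq hfin hk).trans (hK ▸ le_max_left _ _)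
  have hsuppM : ∀ k, fourierCoeff u₀ k ≠ 0 → k ∈ Finset.Ico (-(M : ℤ)) (M : ℤ) := fun k hk => by
    have h1 := abs_le.1 (hsuppK k ((torusFourier_eq_zero_iff u₀ k).not.2 hk))
    rw [Finset.mem_Ico]
    constructor
    · have : (-(M : ℝ)) ≤ k := by linarith
      exact_mod_cast this
    · have : (k : ℝ) < M := by linarith
      exact_mod_cast this
  have hKm : ∀ k : ℤ, |(k : ℝ)| ≤ K → |(k : ℝ)| * mesh M < 1 := fun k hk => by
    have := mul_le_mul_of_nonneg_right hk hm.le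
    nlinarith
  have hv := hsol M hM hmh₀
  obtain ⟨A, hA, c', hwave⟩ := exists_eq_latticePlaneWave α μ T k_c hμ0 hT M (by linarith) hv
    (hband M hM hmh₀)
  have hv0 : discretize M u₀ = c' • latticeMode M A := by
    rw [← hv.1, hwave 0 ⟨by linarith, hT.le⟩]
    simp
  have hcoeff : ∀ l ∈ Finset.Ico (-(M : ℤ)) (M : ℤ),
      (2 * Real.pi : ℂ) * (fourierCoeff u₀ l * meanMultiplier M l) =
        c' * if (A : ZMod (2 * M)) = l then (2 * Real.pi : ℂ) else 0 := fun l hl => by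
    rw [← latticeFourier_discretize M hu₀.1 hsuppM hl, hv0, latticeFourier_smul,
      latticeFourier_latticeMode]
  -- A coefficient of `u₀` off `A` would survive in `d_h u₀`, because its multiplier is nonzero.
  have hsingle : ∀ l, torusFourier u₀ l ≠ 0 → l = A := by
    intro l hl
    by_contra hne
    have hl' := (torusFourier_eq_zero_iff u₀ l).not.1 hl
    have h1 := hcoeff l (hsuppM l hl')
    rw [if_neg fun h => hne (intCast_injOn_Ico hA (hsuppM l hl') h).symm, mul_zero] at h1
    exact mul_ne_zero two_pi_ne_zero' (mul_ne_zero hl'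
      (meanMultiplier_ne_zero M (hKm l (hsuppK l hl)))) h1
  set c := fourierCoeff u₀ A with hc
  have hc' : c' = c * meanMultiplier M A := by
    have h1 := hcoeff A hA
    rw [if_pos rfl, mul_comm c'] at h1
    exact (mul_left_cancel₀ two_pi_ne_zero' h1).symm
  have hR0 : 0 ≤ R := (Real.sqrt_nonneg _).trans hR
  have hKα : 0 ≤ K ^ (1 - α / 2) := by positivity
  have hpoint : ∀ᵐ x : Torus, ‖interpolate M (u_h M t) x - u t x‖ ≤
      (3 + R ^ 2) * (|R| + 1) * (mesh M * K ^ (1 - α / 2)) := by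
    filter_upwards [hu.ae_eq_torusPlaneWave hα hsingle ht] with x hx
    rw [hx, hwave t ⟨by linarith [ht.1], ht.2⟩, ← hc, hc']
    -- When `c = 0` the bound `|A| ≤ K` is not available, but both waves vanish.
    by_cases hc0 : c = 0
    · rw [interpolate_smul]
      simp only [hc0, torusPlaneWave, zero_mul, zero_smul,
        ContinuousMap.zero_apply, sub_zero, norm_zero]
      positivity
    · have hAK := hsuppK A ((torusFourier_eq_zero_iff u₀ A).not.2 hc0)
      have hcR := norm_fourierCoeff_mul_rpow_le_hsNorm (by linarith : 0 ≤ α / 2) hu₀ A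
      refine (norm_interpolate_planeWave_sub_le (by linarith) hα2 hμ1 M (hKm A hAK).le c ht.1
        x).trans ?_
      refine (planeWave_error_le hα hα2 hm hAK (hcR.1.trans hR) (hcR.2.trans hR) ht.2 hT.le
        hmT.le).trans ?_
      rw [abs_of_nonneg hR0]
      gcongr
      linarith
  refine (eLpNorm_two_torus_le hpoint).trans_eq ?_
  congr 1
  ring
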